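/- Let $\Lambda\subset\mathbb R^d$ be a bounded open set, $T>0$, $H=L^2(\Lambda)$ (real-valued) with norm $\|\cdot\|$, and let $\|\cdot\|_1$ be the norm of $H^1(\Lambda)$. Let either $V=H^1_0(\Lambda)$ (Dirichlet condition; put $\beta=0$) or $V=H^1(\Lambda)$ and $\beta(u,v)=\alpha_0\int_{\partial\Lambda}uv\,d\sigma$ with $\alpha_0\in\mathbb R$ (Robin condition; Neumann if $\alpha_0=0$), where $\partial\Lambda$ has finite surface measure if $\alpha_0\ne0$. For $t\in[0,T]$ let $$A(t)u=\sum_{i,j=1}^d\partial_{x_i}\big(q_{ij}(x,t)\partial_{x_j}u\big)-\sum_{j=1}^dq_j(x,t)\partial_{x_j}u-c_0u ,$$ with the bilinear form associated with $-A(t)$ $$a(t)(u,v)=a_\Lambda(t)(u,v)+\beta(u,v),\qquad a_\Lambda(t)(u,v)=\int_\Lambda\Big(\sum_{i,j}q_{ij}(x,t)\,\partial_{x_i}u\,\partial_{x_j}v+\sum_iq_i(x,t)\,\partial_{x_i}u\,v+c_0uv\Big)dx .$$ Assume that * $q_{ij},q_i$ are smooth in $x\in\overline\Lambda$, Hölder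 continuous in $t\in[0,T]$ uniformly in $x$, and uniformly elliptic: $\sum_{i,j}q_{ij}(x,t)\xi_i\xi_j\ge c|\xi|^2$ on $\overline\Lambda\times[0,T]$ for some $c>0$; * the constant $c_0\in\mathbb R$ is such that, for some $\lambda_0>0$, $a(t)(v,v)\ge\lambda_0\|v\|_1^2$ for all $t\in[0,T]$ and all $v\in V$ that are continuous on $\overline\Lambda$; * $t\mapsto A(t)$ is Lipschitz continuous in the weak sense: for all $u,v\in V$ there is $K$ with $|a_\Lambda(t)(u,v)-a_\Lambda(s)(u,v)|\le K|t-s|$ for $s,t\in[0,T]$ (this holds in particular if $t\mapsto a(t)(u,v)$ is twice differentiable on $[0,T]$ for all $u,v\in V$); * $F:[0,T]\times H\to H$ is twice differentiable with respect to $t$ and to $u$, $\partial_uF(\cdot,u)$ is differentiable in $t$, and for a constant $K_3$ and all $t\in[0,T]$, $u\in H$: $\|\partial_t^kF(t,u)\|\le K_3(1+\|u\|)$ and $\|\partial_u^kF(t,u)\|\le K_3$ for $k=1,2$, and $\|\partial_t\partial_uF(t,u)\|_{L(H)}\le K_3$. For a finite triangulation $\mathcal T_h$ of $\Lambda$ (a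 finite simplicial complex whose union is $\overline\Lambda$ or, more generally, is contained in $\overline\Lambda$), let $V_h\subset V$ be the space of those elements of $V$ that are continuous on $\overline\Lambda$, affine on every simplex of $\mathcal T_h$ and zero off the union of the simplices; let $P_h:H\to V_h$ be the $L^2$-orthogonal projection, and let $A_h(t):V_h\to V_h$ be given by $\langle A_h(t)\phi,\chi\rangle=-a(t)(\phi,\chi)$ for $\phi,\chi\in V_h$. For $u_0\in H$ and an integer $M\ge1$ put $\Delta t=T/M$, $t_m=m\Delta t$, $A_{h,m}=A_h(t_m+\frac{\Delta t}2)$, and let $u^h_m$, $0\le m\le M$, be the Magnus–Rosenbrock approximations: $u^h_0=P_hu_0$ and, for $0\le m\le M-1$, $$u^h_{m+1}=e^{\Delta t(A_{h,m}+J^h_m)}u^h_m+\Delta t\,\varphi_1\big(\Delta t(A_{h,m}+J^h_m)\big)\Big[a^h_m\big(t_m+\tfrac{\Delta t}2\big)+G^h_m\big(t_m+\tfrac{\Delta t}2,u^h_m\big)\Big],$$ where $J^h_m=P_h\,\partial_uF(t_m+\frac{\Delta t}2,u^h_m)$, $a^h_m=P_h\,\partial_tF(t_m+\frac{\Delta t}2,u^h_m)$,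 $G^h_m(t,w)=P_hF(t,w)-J^h_mw-a^h_mt$ and $\varphi_1(\Delta t\,B)=\frac1{\Delta t}\int_0^{\Delta t}e^{(\Delta t-s)B}\,ds$. For $\gamma\in(0,1)$ let $(-A_{h,k})^{\gamma}$ be the inverse of $(-A_{h,k})^{-\gamma}=\frac1{\Gamma(\gamma)}\int_0^\infty s^{\gamma-1}e^{sA_{h,k}}\,ds$, and let $(-A_{h,k})^0=\mathbf I$. Then for every $\gamma\in[0,1)$ there is a constant $C$, independent of the triangulation $\mathcal T_h$ (in particular of its mesh size $h$), of $u_0$, and of $M$, $k$, $m$, such that $$\Big\|\Big(\prod_{j=k}^m e^{\Delta t(A_{h,j}+J^h_j)}\Big)(-A_{h,k})^{\gamma}\Big\|\le C\,t_{m-k+1}^{-\gamma},\qquad 0\le k\le m<M .$$ Here $\prod_{j=k}^mH_j=H_mH_{m-1}\cdots H_k$, and the norm is the operator norm on $V_h$ with respect to $\|\cdot\|$. -/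

import Mathlib

open MeasureTheory Filter Topology
open scoped ContDiff

noncomputable section

namespace MagnusRosenbrock

/-! ### The spaces `L²(Λ)`, `H¹(Λ)`, `H¹₀(Λ)` -/

/-- `ℝ^d` with its Euclidean norm. -/
abbrev Space (d : ℕ) : Type := EuclideanSpace ℝ (Fin d)

/-- The Hilbert space `H = L²(Λ)` of real functions. -/
abbrev L2 {d : ℕ} (Λ : Set (Space d)) : Type := Lp ℝ 2 (volume.restrict Λ)

/-- The classical partial derivative `∂φ/∂xᵢ`. -/
def pderiv {d : ℕ} (i : Fin d) (φ : Space d → ℝ) (x : Space d) : ℝ :=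
  fderiv ℝ φ x (EuclideanSpace.single i 1)

/-- Test functions `φ ∈ C_c^∞(Λ)`. -/
def IsTestFunction {d : ℕ} (Λ : Set (Space d)) (φ : Space d → ℝ) : Prop :=
  ContDiff ℝ ∞ φ ∧ HasCompactSupport φ ∧ tsupport φ ⊆ Λ

/-- `g ∈ L²(Λ)` is the weak partial derivative `∂u/∂xᵢ` of `u ∈ L²(Λ)`. -/
def HasWeakPartial {d : ℕ} {Λ : Set (Space d)} (i : Fin d) (u g : L2 Λ) : Prop :=
  ∀ φ : Space d → ℝ, IsTestFunction Λ φ →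
    ∫ x in Λ, u x * pderiv i φ x = -∫ x in Λ, g x * φ x

open Classical in
/-- The weak partial derivative `∂u/∂xᵢ` (zero when there is none in `L²(Λ)`). -/
def weakPartial {d : ℕ} {Λ : Set (Space d)} (i : Fin d) (u : L2 Λ) : L2 Λ :=
  if h : ∃ g : L2 Λ, HasWeakPartial i u g then h.choose else 0

/-- `H¹(Λ)`: all weak first order partial derivatives exist in `L²(Λ)`. -/
def MemH1 {d : ℕ} {Λ : Set (Space d)} (u : L2 Λ) : Prop :=
  ∀ i : Fin d, ∃ g : L2 Λ, HasWeakPartial i u g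

/-- `‖u‖₁²`, the square of the norm of `H¹(Λ)`. -/
def normH1Sq {d : ℕ} {Λ : Set (Space d)} (u : L2 Λ) : ℝ :=
  ‖u‖ ^ 2 + ∑ i : Fin d, ‖weakPartial i u‖ ^ 2

/-- `H¹₀(Λ)`: the closure of `C_c^∞(Λ)` in the norm of `H¹(Λ)`; the limits `g i` are then the weak
partial derivatives of `u`. -/
def MemH10 {d : ℕ} {Λ : Set (Space d)} (u : L2 Λ) : Prop :=
  ∃ (g : Fin d → L2 Λ) (φ : ℕ → Space d → ℝ), (∀ n, IsTestFunction Λ (φ n)) ∧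
    Tendsto (fun n => eLpNorm (fun x => φ n x - u x) 2 (volume.restrict Λ)) atTop (𝓝 0) ∧
    ∀ i : Fin d, Tendsto
      (fun n => eLpNorm (fun x => pderiv i (φ n) x - g i x) 2 (volume.restrict Λ)) atTop (𝓝 0)

/-- Boundary conditions: homogeneous Dirichlet, or Robin `∂u/∂ν_A + α₀ u = 0`
(Neumann is `robin 0`). -/
inductive BoundaryCondition where
  | dirichlet : BoundaryCondition
  | robin : ℝ → BoundaryCondition

/-- The energy space `V`: `H¹₀(Λ)` for Dirichlet, `H¹(Λ)` for Robin and Neumann conditions. -/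
def MemV {d : ℕ} {Λ : Set (Space d)} : BoundaryCondition → L2 Λ → Prop
  | .dirichlet, u => MemH10 u
  | .robin _, u => MemH1 u

/-! ### The bilinear forms `a(t)` -/

/-- Coefficients of
`A(t)u = ∑ᵢⱼ ∂ᵢ(qᵢⱼ(x,t) ∂ⱼu) - ∑ⱼ qⱼ(x,t) ∂ⱼu - c₀ u`
(the shift by `c₀` makes the form coercive; the compensating term is part of `F`). -/
structure Coefficients (d : ℕ) where
  q : Fin d → Fin d → Space d → ℝ → ℝ
  b : Fin d → Space d → ℝ → ℝ
  c₀ : ℝ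

/-- The part of `a(t)(u,v)` that is an integral over `Λ`. -/
def volumeForm {d : ℕ} {Λ : Set (Space d)} (co : Coefficients d) (t : ℝ) (u v : L2 Λ) : ℝ :=
  ∫ x in Λ, ((∑ i : Fin d, ∑ j : Fin d,
      co.q i j x t * weakPartial i u x * weakPartial j v x)
    + (∑ i : Fin d, co.b i x t * weakPartial i u x * v x)
    + co.c₀ * (u x * v x))

/-- `f` is a representative of `u` that is continuous up to the boundary. -/
def IsContRep {d : ℕ} {Λ : Set (Space d)} (u : L2 Λ) (f : Space d → ℝ) : Prop :=
  ContinuousOn f (closure Λ) ∧ u =ᵐ[volume.restrict Λ] f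

open Classical in
/-- A representative of `u` that is continuous on `closure Λ`, if there is one. When `Λ` is open
its values on `closure Λ`, in particular the boundary values of `u`, are determined by `u`. -/
def contRep {d : ℕ} {Λ : Set (Space d)} (u : L2 Λ) : Space d → ℝ :=
  if h : ∃ f, IsContRep u f then h.choose else 0

/-- The boundary part `∫_{∂Λ} α₀ u v` of `a(t)(u,v)`, with respect to the `(d-1)`-dimensional
surface measure, for `u, v` continuous up to the boundary. -/
def boundaryForm {d : ℕ} {Λ : Set (Space d)} : BoundaryCondition → L2 Λ → L2 Λ → ℝ
  | .dirichlet, _, _ => 0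
  | .robin α₀, u, v =>
      ∫ x in frontier Λ, α₀ * contRep u x * contRep v x
        ∂(Measure.euclideanHausdorffMeasure (d - 1))

/-- The form `a(t)` associated with `-A(t)`, on functions of `V` continuous up to the boundary. -/
def form {d : ℕ} {Λ : Set (Space d)} (bc : BoundaryCondition) (co : Coefficients d) (t : ℝ)
    (u v : L2 Λ) : ℝ :=
  volumeForm co t u v + boundaryForm bc u v

/-- Standing assumptions on the family `A(t)`, `t ∈ [0,T]`. -/
structure IsAdmissible {d : ℕ} (Λ : Set (Space d)) (T : ℝ) (bc : BoundaryCondition)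
    (co : Coefficients d) : Prop where
  /-- the coefficients are smooth in `x ∈ closure Λ` -/
  smooth_q : ∀ i j, ∀ t ∈ Set.Icc 0 T, ContDiffOn ℝ ∞ (fun x => co.q i j x t) (closure Λ)
  smooth_b : ∀ i, ∀ t ∈ Set.Icc 0 T, ContDiffOn ℝ ∞ (fun x => co.b i x t) (closure Λ)
  /-- the coefficients are Hölder continuous in `t` -/
  holder_q : ∀ i j, ∃ K η : ℝ, 0 < η ∧ ∀ x ∈ closure Λ, ∀ s ∈ Set.Icc 0 T, ∀ t ∈ Set.Icc 0 T,
    |co.q i j x t - co.q i j x s| ≤ K * |t - s| ^ η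
  holder_b : ∀ i, ∃ K η : ℝ, 0 < η ∧ ∀ x ∈ closure Λ, ∀ s ∈ Set.Icc 0 T, ∀ t ∈ Set.Icc 0 T,
    |co.b i x t - co.b i x s| ≤ K * |t - s| ^ η
  /-- uniform ellipticity -/
  elliptic : ∃ c : ℝ, 0 < c ∧ ∀ x ∈ closure Λ, ∀ t ∈ Set.Icc 0 T, ∀ ξ : Fin d → ℝ,
    c * ∑ i, ξ i ^ 2 ≤ ∑ i, ∑ j, co.q i j x t * ξ i * ξ j
  /-- `c₀` was chosen, by Gårding's inequality, so that `a(t)` is coercive on `V` -/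
  coercive : ∃ lam : ℝ, 0 < lam ∧ ∀ t ∈ Set.Icc 0 T, ∀ v : L2 Λ, MemV bc v →
    (∃ f, IsContRep v f) → lam * normH1Sq v ≤ form bc co t v v
  /-- `t ↦ A(t)` is Lipschitz continuous, in the weak sense that `t ↦ a(t)(u,v)` is, for all
  `u, v ∈ V` (the boundary part of `a(t)` does not depend on `t`) -/
  lipschitz : ∀ u v : L2 Λ, MemV bc u → MemV bc v → ∃ K : ℝ,
    ∀ s ∈ Set.Icc 0 T, ∀ t ∈ Set.Icc 0 T,
      |volumeForm co t u v - volumeForm co s u v| ≤ K * |t - s|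
  /-- for a genuine Robin condition, the boundary has finite surface measure -/
  finite_boundary : ∀ α₀ : ℝ, bc = .robin α₀ → α₀ ≠ 0 →
    Measure.euclideanHausdorffMeasure (d - 1) (frontier Λ) < ⊤

/-- `g` is twice differentiable on the interval `[0,T]`. -/
def TwiceDifferentiableOn {X : Type*} [NormedAddCommGroup X] [NormedSpace ℝ X]
    (T : ℝ) (g : ℝ → X) : Prop :=
  DifferentiableOn ℝ g (Set.Icc 0 T) ∧
    DifferentiableOn ℝ (derivWithin g (Set.Icc 0 T)) (Set.Icc 0 T)

/-- Assumptions on the nonlinearity `F : [0,T] × H → H`: twice differentiable in both variables,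
with bounded derivatives. -/
structure IsSmoothNonlinearity {H : Type*} [NormedAddCommGroup H] [NormedSpace ℝ H]
    (T : ℝ) (F : ℝ → H → H) (K₃ : ℝ) : Prop where
  diff_t : ∀ u, TwiceDifferentiableOn T (fun t => F t u)
  diff_u : ∀ t ∈ Set.Icc 0 T, Differentiable ℝ (F t) ∧ Differentiable ℝ (fderiv ℝ (F t))
  diff_tu : ∀ u, DifferentiableOn ℝ (fun t => fderiv ℝ (F t) u) (Set.Icc 0 T)
  bound_t : ∀ t ∈ Set.Icc 0 T, ∀ u,
    ‖derivWithin (fun s => F s u) (Set.Icc 0 T) t‖ ≤ K₃ * (1 + ‖u‖)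
  bound_tt : ∀ t ∈ Set.Icc 0 T, ∀ u,
    ‖derivWithin (derivWithin (fun s => F s u) (Set.Icc 0 T)) (Set.Icc 0 T) t‖
      ≤ K₃ * (1 + ‖u‖)
  bound_u : ∀ t ∈ Set.Icc 0 T, ∀ u, ‖fderiv ℝ (F t) u‖ ≤ K₃
  bound_uu : ∀ t ∈ Set.Icc 0 T, ∀ u, ‖fderiv ℝ (fderiv ℝ (F t)) u‖ ≤ K₃
  bound_tu : ∀ t ∈ Set.Icc 0 T, ∀ u,
    ‖derivWithin (fun s => fderiv ℝ (F s) u) (Set.Icc 0 T) t‖ ≤ K₃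

/-! ### Finite elements -/

/-- A finite triangulation of `Λ` by simplices. Its union is contained in `closure Λ`; it is equal
to `closure Λ` for polyhedral `Λ` triangulated exactly. -/
structure Triangulation {d : ℕ} (Λ : Set (Space d)) where
  complex : Geometry.SimplicialComplex ℝ (Space d)
  finite : complex.faces.Finite
  space_subset : complex.space ⊆ closure Λ

/-- Continuous functions on `closure Λ` that are affine on every simplex (and extended by zero). -/
def IsPiecewiseLinear {d : ℕ} {Λ : Set (Space d)} (𝒯 : Triangulation Λ) (f : Space d → ℝ) :
    Prop :=
  ContinuousOn f (closure Λ) ∧ (∀ x, x ∉ 𝒯.complex.space → f x = 0) ∧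
    ∀ s ∈ 𝒯.complex.faces, ∃ g : Space d →ᵃ[ℝ] ℝ,
      Set.EqOn f g (convexHull ℝ (s : Set (Space d)))

/-! Closure properties that make the finite element space a vector space. -/

lemma IsTestFunction.zero {d : ℕ} {Λ : Set (Space d)} : IsTestFunction Λ (fun _ => 0) := by
  refine ⟨contDiff_const, HasCompactSupport.zero, ?_⟩
  have : tsupport (fun _ : Space d => (0 : ℝ)) = ∅ := tsupport_eq_empty_iff.2 rfl
  simp [this]

lemma IsTestFunction.add {d : ℕ} {Λ : Set (Space d)} {φ ψ : Space d → ℝ}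
    (h : IsTestFunction Λ φ) (h' : IsTestFunction Λ ψ) :
    IsTestFunction Λ (fun x => φ x + ψ x) :=
  ⟨h.1.add h'.1, h.2.1.add h'.2.1,
    (tsupport_add φ ψ).trans (Set.union_subset h.2.2 h'.2.2)⟩

lemma IsTestFunction.smul {d : ℕ} {Λ : Set (Space d)} {φ : Space d → ℝ} (c : ℝ)
    (h : IsTestFunction Λ φ) : IsTestFunction Λ (fun x => c * φ x) :=
  ⟨contDiff_const.mul h.1, h.2.1.mul_left, (tsupport_mul_subset_right).trans h.2.2⟩

lemma IsTestFunction.continuous_pderiv {d : ℕ} {Λ : Set (Space d)} {φ : Space d → ℝ}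
    (h : IsTestFunction Λ φ) (i : Fin d) : Continuous (pderiv i φ) :=
  (h.1.continuous_fderiv (by simp)).clm_apply continuous_const

lemma IsTestFunction.integrable_mul {d : ℕ} {Λ : Set (Space d)} {φ : Space d → ℝ}
    (h : IsTestFunction Λ φ) (u : L2 Λ) :
    Integrable (fun x => u x * φ x) (volume.restrict Λ) :=
  MemLp.integrable_mul (p := 2) (q := 2) (Lp.memLp u) ((h.1.continuous.memLp_of_hasCompactSupport h.2.1).restrict Λ)

lemma IsTestFunction.integrable_mul_pderiv {d : ℕ} {Λ : Set (Space d)} {φ : Space d → ℝ}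
    (h : IsTestFunction Λ φ) (u : L2 Λ) (i : Fin d) :
    Integrable (fun x => u x * pderiv i φ x) (volume.restrict Λ) :=
  MemLp.integrable_mul (p := 2) (q := 2) (Lp.memLp u) (((h.continuous_pderiv i).memLp_of_hasCompactSupport
    (h.2.1.fderiv_apply (𝕜 := ℝ) _)).restrict Λ)

lemma HasWeakPartial.zero {d : ℕ} {Λ : Set (Space d)} (i : Fin d) :
    HasWeakPartial i (0 : L2 Λ) 0 := by
  intro φ _
  have h : ∀ ψ : Space d → ℝ, ∫ x in Λ, (0 : L2 Λ) x * ψ x = 0 := by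
    intro ψ
    rw [← integral_zero (Space d) ℝ (μ := volume.restrict Λ)]
    refine integral_congr_ae ?_
    filter_upwards [Lp.coeFn_zero ℝ 2 (volume.restrict Λ)] with x hx
    rw [hx, Pi.zero_apply, zero_mul]
  rw [h, h, neg_zero]

lemma HasWeakPartial.add {d : ℕ} {Λ : Set (Space d)} {i : Fin d} {u v g k : L2 Λ}
    (hu : HasWeakPartial i u g) (hv : HasWeakPartial i v k) :
    HasWeakPartial i (u + v) (g + k) := by
  intro φ hφ
  have e1 : ∫ x in Λ, (u + v : L2 Λ) x * pderiv i φ x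
      = (∫ x in Λ, u x * pderiv i φ x) + ∫ x in Λ, v x * pderiv i φ x := by
    rw [← integral_add (hφ.integrable_mul_pderiv u i) (hφ.integrable_mul_pderiv v i)]
    refine integral_congr_ae ?_
    filter_upwards [Lp.coeFn_add u v] with x hx
    rw [hx, Pi.add_apply, add_mul]
  have e2 : ∫ x in Λ, (g + k : L2 Λ) x * φ x
      = (∫ x in Λ, g x * φ x) + ∫ x in Λ, k x * φ x := by
    rw [← integral_add (hφ.integrable_mul g) (hφ.integrable_mul k)]
    refine integral_congr_ae ?_
    filter_upwards [Lp.coeFn_add g k] with x hx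
    rw [hx, Pi.add_apply, add_mul]
  rw [e1, e2, hu φ hφ, hv φ hφ]
  ring

lemma HasWeakPartial.smul {d : ℕ} {Λ : Set (Space d)} {i : Fin d} {u g : L2 Λ} (c : ℝ)
    (hu : HasWeakPartial i u g) : HasWeakPartial i (c • u) (c • g) := by
  intro φ hφ
  have e : ∀ (w : L2 Λ) (ψ : Space d → ℝ), ∫ x in Λ, (c • w : L2 Λ) x * ψ x
      = c * ∫ x in Λ, w x * ψ x := by
    intro w ψ
    rw [← integral_const_mul]
    refine integral_congr_ae ?_
    filter_upwards [Lp.coeFn_smul c w] with x hx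
    rw [hx, Pi.smul_apply, smul_eq_mul, mul_assoc]
  rw [e, e, hu φ hφ]
  ring

lemma tendsto_eLpNorm_add {d : ℕ} {Λ : Set (Space d)} {φ ψ : ℕ → Space d → ℝ} {u v : L2 Λ}
    (hφ : ∀ n, Continuous (φ n)) (hψ : ∀ n, Continuous (ψ n))
    (h : Tendsto (fun n => eLpNorm (fun x => φ n x - u x) 2 (volume.restrict Λ)) atTop (𝓝 0))
    (h' : Tendsto (fun n => eLpNorm (fun x => ψ n x - v x) 2 (volume.restrict Λ)) atTop (𝓝 0)) :
    Tendsto (fun n => eLpNorm (fun x => (φ n x + ψ n x) - (u + v : L2 Λ) x) 2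
      (volume.restrict Λ)) atTop (𝓝 0) := by
  have hs := h.add h'
  rw [add_zero] at hs
  refine tendsto_of_tendsto_of_tendsto_of_le_of_le tendsto_const_nhds hs
    (fun _ => zero_le) fun n => ?_
  have e : eLpNorm (fun x => (φ n x + ψ n x) - (u + v : L2 Λ) x) 2 (volume.restrict Λ)
      = eLpNorm ((fun x => φ n x - u x) + fun x => ψ n x - v x) 2 (volume.restrict Λ) := by
    refine eLpNorm_congr_ae ?_
    filter_upwards [Lp.coeFn_add u v] with x hx
    simp only [hx, Pi.add_apply]
    ring
  rw [e]
  exact eLpNorm_add_le ((hφ n).aestronglyMeasurable.sub (Lp.aestronglyMeasurable u))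
    ((hψ n).aestronglyMeasurable.sub (Lp.aestronglyMeasurable v)) (by norm_num)

lemma tendsto_eLpNorm_smul {d : ℕ} {Λ : Set (Space d)} {φ : ℕ → Space d → ℝ} {u : L2 Λ} (c : ℝ)
    (h : Tendsto (fun n => eLpNorm (fun x => φ n x - u x) 2 (volume.restrict Λ)) atTop (𝓝 0)) :
    Tendsto (fun n => eLpNorm (fun x => c * φ n x - (c • u : L2 Λ) x) 2
      (volume.restrict Λ)) atTop (𝓝 0) := by
  have hs := ENNReal.Tendsto.const_mul (a := ‖c‖ₑ) h (Or.inr (by simp))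
  rw [mul_zero] at hs
  refine hs.congr fun n => ?_
  rw [← eLpNorm_const_smul]
  refine eLpNorm_congr_ae ?_
  filter_upwards [Lp.coeFn_smul c u] with x hx
  simp only [hx, Pi.smul_apply, smul_eq_mul]
  ring

lemma MemV.zero {d : ℕ} {Λ : Set (Space d)} (bc : BoundaryCondition) : MemV bc (0 : L2 Λ) := by
  cases bc with
  | robin α₀ => exact fun i => ⟨0, HasWeakPartial.zero i⟩
  | dirichlet =>
    have h0 : ∀ ψ : Space d → ℝ, (∀ x, ψ x = 0) →
        eLpNorm (fun x => ψ x - (0 : L2 Λ) x) 2 (volume.restrict Λ) = 0 := by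
      intro ψ hψ
      rw [← eLpNorm_zero (α := Space d) (ε := ℝ) (p := 2) (μ := volume.restrict Λ)]
      refine eLpNorm_congr_ae ?_
      filter_upwards [Lp.coeFn_zero ℝ 2 (volume.restrict Λ)] with x hx
      rw [hx, hψ x, Pi.zero_apply, sub_zero]
    refine ⟨fun _ => 0, fun _ _ => 0, fun _ => IsTestFunction.zero, ?_, fun i => ?_⟩
    · simp only [h0 (fun _ => 0) (fun _ => rfl)]
      exact tendsto_const_nhds
    · have : ∀ x, pderiv i (fun _ : Space d => (0 : ℝ)) x = 0 := fun x => by simp [pderiv]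
      simp only [h0 _ this]
      exact tendsto_const_nhds

lemma MemV.add {d : ℕ} {Λ : Set (Space d)} {bc : BoundaryCondition} {u v : L2 Λ}
    (hu : MemV bc u) (hv : MemV bc v) : MemV bc (u + v) := by
  cases bc with
  | robin α₀ =>
    intro i
    obtain ⟨g, hg⟩ := hu i
    obtain ⟨k, hk⟩ := hv i
    exact ⟨g + k, hg.add hk⟩
  | dirichlet =>
    obtain ⟨g, φ, h1, h2, h3⟩ := hu
    obtain ⟨k, ψ, k1, k2, k3⟩ := hv
    refine ⟨fun i => g i + k i, fun n x => φ n x + ψ n x, fun n => (h1 n).add (k1 n),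
      tendsto_eLpNorm_add (fun n => (h1 n).1.continuous) (fun n => (k1 n).1.continuous) h2 k2,
      fun i => ?_⟩
    refine (tendsto_eLpNorm_add (fun n => (h1 n).continuous_pderiv i)
      (fun n => (k1 n).continuous_pderiv i) (h3 i) (k3 i)).congr fun n => ?_
    congr 1
    funext x
    congr 1
    have a := ((h1 n).1.differentiable (by simp)) x
    have b := ((k1 n).1.differentiable (by simp)) x
    simp [pderiv, fderiv_fun_add a b]

lemma MemV.smul {d : ℕ} {Λ : Set (Space d)} {bc : BoundaryCondition} {u : L2 Λ} (c : ℝ)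
    (hu : MemV bc u) : MemV bc (c • u) := by
  cases bc with
  | robin α₀ =>
    intro i
    obtain ⟨g, hg⟩ := hu i
    exact ⟨c • g, hg.smul c⟩
  | dirichlet =>
    obtain ⟨g, φ, h1, h2, h3⟩ := hu
    refine ⟨fun i => c • g i, fun n x => c * φ n x, fun n => (h1 n).smul c,
      tendsto_eLpNorm_smul c h2, fun i => ?_⟩
    refine (tendsto_eLpNorm_smul c (h3 i)).congr fun n => ?_
    congr 1
    funext x
    congr 1
    have a := ((h1 n).1.differentiable (by simp)) x
    simp [pderiv, fderiv_const_mul a]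

/-- The piecewise linear functions on a triangulation, as a vector space of functions. -/
def piecewiseLinear {d : ℕ} {Λ : Set (Space d)} (𝒯 : Triangulation Λ) :
    Submodule ℝ (Space d → ℝ) where
  carrier := {f | IsPiecewiseLinear 𝒯 f}
  zero_mem' := ⟨continuousOn_const, fun _ _ => rfl, fun _ _ => ⟨0, fun _ _ => rfl⟩⟩
  add_mem' := by
    rintro f g ⟨f1, f2, f3⟩ ⟨g1, g2, g3⟩
    refine ⟨f1.add g1, fun x hx => by simp [f2 x hx, g2 x hx], fun s hs => ?_⟩
    obtain ⟨a, ha⟩ := f3 s hs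
    obtain ⟨b, hb⟩ := g3 s hs
    exact ⟨a + b, fun x hx => by simp [ha hx, hb hx]⟩
  smul_mem' := by
    rintro c f ⟨f1, f2, f3⟩
    refine ⟨f1.const_smul c, fun x hx => by simp [f2 x hx], fun s hs => ?_⟩
    obtain ⟨a, ha⟩ := f3 s hs
    exact ⟨c • a, fun x hx => by simp [ha hx]⟩

/-- The finite element space `V_h ⊂ V`: the elements of `V` that are continuous and piecewise
linear. -/
def feSpace {d : ℕ} {Λ : Set (Space d)} (bc : BoundaryCondition) (𝒯 : Triangulation Λ) :
    Submodule ℝ (L2 Λ) where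
  carrier := {u | MemV bc u ∧ ∃ f, IsPiecewiseLinear 𝒯 f ∧ u =ᵐ[volume.restrict Λ] f}
  zero_mem' := ⟨MemV.zero bc, 0, (piecewiseLinear 𝒯).zero_mem, Lp.coeFn_zero _ _ _⟩
  add_mem' := by
    rintro u v ⟨hu, f, hf, hf'⟩ ⟨hv, g, hg, hg'⟩
    exact ⟨hu.add hv, f + g, (piecewiseLinear 𝒯).add_mem hf hg,
      (Lp.coeFn_add u v).trans (hf'.add hg')⟩
  smul_mem' := by
    rintro c u ⟨hu, f, hf, hf'⟩
    exact ⟨hu.smul c, c • f, (piecewiseLinear 𝒯).smul_mem c hf,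
      (Lp.coeFn_smul c u).trans (hf'.const_smul c)⟩

instance piecewiseLinear_finiteDimensional {d : ℕ} {Λ : Set (Space d)} (𝒯 : Triangulation Λ) :
    FiniteDimensional ℝ (piecewiseLinear 𝒯) := by
  have hfin : 𝒯.complex.vertices.Finite := by
    rw [Geometry.SimplicialComplex.vertices_eq]
    exact 𝒯.finite.biUnion fun s _ => s.finite_toSet
  have : Finite 𝒯.complex.vertices := hfin
  let ev : piecewiseLinear 𝒯 →ₗ[ℝ] (𝒯.complex.vertices → ℝ) :=
    { toFun := fun f p => f.1 p
      map_add' := fun _ _ => rfl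
      map_smul' := fun _ _ => rfl }
  refine Module.Finite.of_injective ev ((injective_iff_map_eq_zero ev).2 ?_)
  rintro ⟨f, hf⟩ h
  ext x
  by_cases hx : x ∈ 𝒯.complex.space
  · obtain ⟨s, hs, hxs⟩ := Geometry.SimplicialComplex.mem_space_iff.1 hx
    obtain ⟨a, ha⟩ := hf.2.2 s hs
    have hsub : (s : Set (Space d)) ⊆ a ⁻¹' {0} := by
      intro p hp
      have hpv : p ∈ 𝒯.complex.vertices := by
        rw [Geometry.SimplicialComplex.vertices_eq]
        exact Set.mem_biUnion hs hp
      have := congrFun h ⟨p, hpv⟩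
      have e := ha (subset_convexHull ℝ _ hp)
      rw [Set.mem_preimage, ← e]
      exact this
    have := convexHull_min hsub ((convex_singleton (0 : ℝ)).affine_preimage a) hxs
    exact (ha hxs).trans this
  · exact hf.2.1 x hx

instance feSpace_finiteDimensional {d : ℕ} {Λ : Set (Space d)} (bc : BoundaryCondition)
    (𝒯 : Triangulation Λ) : FiniteDimensional ℝ (feSpace bc 𝒯) := by
  let R : Submodule ℝ (piecewiseLinear 𝒯) :=
    { carrier := {f | MemLp f.1 2 (volume.restrict Λ)}
      zero_mem' := MemLp.zero
      add_mem' := fun h h' => MemLp.add h h'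
      smul_mem' := fun c _ h => MemLp.const_smul h c }
  let Φ : R →ₗ[ℝ] L2 Λ :=
    { toFun := fun f => MemLp.toLp f.1.1 f.2
      map_add' := fun f g => MemLp.toLp_add f.2 g.2
      map_smul' := fun c f => MemLp.toLp_const_smul c f.2 }
  have hle : feSpace bc 𝒯 ≤ LinearMap.range Φ := by
    rintro u ⟨_, f, hf, huf⟩
    have hm : MemLp f 2 (volume.restrict Λ) := (memLp_congr_ae huf).1 (Lp.memLp u)
    refine ⟨⟨⟨f, hf⟩, hm⟩, ?_⟩
    exact Lp.ext ((MemLp.coeFn_toLp hm).trans huf.symm)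
  exact Submodule.finiteDimensional_of_le hle

/-! ### The discrete operators and the scheme -/

/-- Bounded operators on `V_h` (with the norm of `H`). -/
abbrev DiscreteOp {d : ℕ} {Λ : Set (Space d)} (bc : BoundaryCondition) (𝒯 : Triangulation Λ) :
    Type :=
  feSpace bc 𝒯 →L[ℝ] feSpace bc 𝒯

/-- The `L²`-projection `P_h : H → V_h`. -/
def proj {d : ℕ} {Λ : Set (Space d)} (bc : BoundaryCondition) (𝒯 : Triangulation Λ) :
    L2 Λ →L[ℝ] feSpace bc 𝒯 :=
  (feSpace bc 𝒯).orthogonalProjectionOnto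

open Classical in
/-- The discrete operator `A_h(t) : V_h → V_h`, `(A_h(t)φ, χ) = -a(t)(φ, χ)` for `φ, χ ∈ V_h`. -/
def discreteA {d : ℕ} {Λ : Set (Space d)} (bc : BoundaryCondition) (co : Coefficients d)
    (𝒯 : Triangulation Λ) (t : ℝ) : DiscreteOp bc 𝒯 :=
  if h : ∃ B : DiscreteOp bc 𝒯, ∀ φ χ : feSpace bc 𝒯,
      inner ℝ (B φ) χ = -form bc co t (φ : L2 Λ) (χ : L2 Λ)
  then h.choose else 0

/-! The operator `A_h(t)` exists, so its defining property holds (`discreteA_spec`). -/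

lemma HasWeakPartial.unique {d : ℕ} {Λ : Set (Space d)} (hΛ : IsOpen Λ) {i : Fin d}
    {u g k : L2 Λ} (hg : HasWeakPartial i u g) (hk : HasWeakPartial i u k) : g = k := by
  have hloc : LocallyIntegrableOn (fun x => g x - k x) Λ volume := by
    have : LocallyIntegrable (fun x => g x - k x) (volume.restrict Λ) :=
      ((Lp.memLp g).sub (Lp.memLp k)).locallyIntegrable (by norm_num)
    intro x hx
    obtain ⟨U, hU, hI⟩ := this x
    refine ⟨U ∩ Λ, inter_mem (mem_nhdsWithin_of_mem_nhds hU) self_mem_nhdsWithin, ?_⟩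
    rw [IntegrableOn, Measure.restrict_restrict' hΛ.measurableSet] at hI
    exact hI
  have h0 := hΛ.ae_eq_zero_of_integral_contDiff_smul_eq_zero (μ := volume) hloc (by
    intro φ h1 h2 h3
    have ht : IsTestFunction Λ φ := ⟨h1, h2, h3⟩
    have e : ∫ x, φ x • (g x - k x) = ∫ x in Λ, φ x • (g x - k x) := by
      rw [setIntegral_eq_integral_of_forall_compl_eq_zero]
      intro x hx
      have : φ x = 0 := by
        by_contra hne
        exact hx (h3 (subset_tsupport _ hne))
      simp [this]
    rw [e]
    have e2 : ∫ x in Λ, φ x • (g x - k x) = (∫ x in Λ, g x * φ x) - ∫ x in Λ, k x * φ x := by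
      rw [← integral_sub (ht.integrable_mul g) (ht.integrable_mul k)]
      congr 1
      funext x
      rw [smul_eq_mul]
      ring
    rw [e2]
    have a := hg φ ht
    have b := hk φ ht
    linarith)
  refine Lp.ext ?_
  rw [← ae_restrict_iff' hΛ.measurableSet] at h0
  filter_upwards [h0] with x hx
  linarith

lemma weakPartial_eq {d : ℕ} {Λ : Set (Space d)} (hΛ : IsOpen Λ) {i : Fin d}
    {u g : L2 Λ} (hg : HasWeakPartial i u g) : weakPartial i u = g := by
  have h : ∃ g : L2 Λ, HasWeakPartial i u g := ⟨g, hg⟩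
  rw [weakPartial, dif_pos h]
  exact h.choose_spec.unique hΛ hg

/-- `H¹₀(Λ) ⊆ H¹(Λ)`. -/
lemma MemH10.hasWeakPartial {d : ℕ} {Λ : Set (Space d)} {u : L2 Λ} (hu : MemH10 u) (i : Fin d) :
    ∃ g : L2 Λ, HasWeakPartial i u g := by
  obtain ⟨g, φ, h1, h2, h3⟩ := hu
  refine ⟨g i, fun ψ hψ => ?_⟩
  have key : ∀ (f : ℕ → Space d → ℝ) (w : L2 Λ) (χ : Space d → ℝ),
      (∀ n, MemLp (f n) 2 (volume.restrict Λ)) → MemLp χ 2 (volume.restrict Λ) →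
      Tendsto (fun n => eLpNorm (fun x => f n x - w x) 2 (volume.restrict Λ)) atTop (𝓝 0) →
      Tendsto (fun n => ∫ x in Λ, f n x * χ x) atTop (𝓝 (∫ x in Λ, w x * χ x)) := by
    intro f w χ hf hχ ht
    have hL : Tendsto (fun n => (hf n).toLp) atTop (𝓝 w) := by
      rw [tendsto_iff_edist_tendsto_0]
      refine ht.congr fun n => ?_
      rw [Lp.edist_def]
      refine eLpNorm_congr_ae ?_
      filter_upwards [(hf n).coeFn_toLp] with x hx
      simp [hx]
    have hin := (hL.inner (tendsto_const_nhds (x := hχ.toLp)) (𝕜 := ℝ))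
    have e : ∀ (w' : L2 Λ), inner ℝ w' hχ.toLp = ∫ x in Λ, w' x * χ x := by
      intro w'
      rw [L2.inner_def]
      refine integral_congr_ae ?_
      filter_upwards [hχ.coeFn_toLp] with x hx
      simp [hx, mul_comm]
    rw [e] at hin
    refine hin.congr fun n => ?_
    rw [e]
    refine integral_congr_ae ?_
    filter_upwards [(hf n).coeFn_toLp] with x hx
    rw [hx]
  have mem : ∀ (η : Space d → ℝ), IsTestFunction Λ η → MemLp η 2 (volume.restrict Λ) :=
    fun η h => (h.1.continuous.memLp_of_hasCompactSupport h.2.1).restrict Λ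
  have mem' : ∀ (η : Space d → ℝ), IsTestFunction Λ η → MemLp (pderiv i η) 2 (volume.restrict Λ) :=
    fun η h => ((h.continuous_pderiv i).memLp_of_hasCompactSupport
      (h.2.1.fderiv_apply (𝕜 := ℝ) _)).restrict Λ
  have l1 := key φ u (pderiv i ψ) (fun n => mem _ (h1 n)) (mem' ψ hψ) h2
  have l2 := key (fun n => pderiv i (φ n)) (g i) ψ (fun n => mem' _ (h1 n)) (mem ψ hψ) (h3 i)
  refine tendsto_nhds_unique l1 (l2.neg.congr fun n => ?_)
  have on : ∀ η : Space d → ℝ, (∀ x ∉ Λ, η x = 0) → ∫ x in Λ, η x = ∫ x, η x :=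
    fun η h => setIntegral_eq_integral_of_forall_compl_eq_zero fun x hx => h x hx
  have z : ∀ x ∉ Λ, ψ x = 0 := fun x hx => by
    by_contra hne
    exact hx (hψ.2.2 (subset_tsupport _ hne))
  have z' : ∀ x ∉ Λ, φ n x = 0 := fun x hx => by
    by_contra hne
    exact hx ((h1 n).2.2 (subset_tsupport _ hne))
  rw [on _ fun x hx => by simp [z x hx], on _ fun x hx => by simp [z' x hx]]
  have := integral_mul_fderiv_eq_neg_fderiv_mul_of_integrable (μ := volume)
    (f := φ n) (g := ψ) (v := EuclideanSpace.single i 1) (𝕜 := ℝ)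
    ?_ ?_ ?_ (fun x _ => (h1 n).1.differentiable (by simp) x)
    (fun x _ => hψ.1.differentiable (by simp) x)
  · exact this.symm
  · exact (((h1 n).continuous_pderiv i).mul hψ.1.continuous).integrable_of_hasCompactSupport
      hψ.2.1.mul_left
  · exact ((h1 n).1.continuous.mul (hψ.continuous_pderiv i)).integrable_of_hasCompactSupport
      (h1 n).2.1.mul_right
  · exact ((h1 n).1.continuous.mul hψ.1.continuous).integrable_of_hasCompactSupport
      hψ.2.1.mul_left

lemma MemV.memH1 {d : ℕ} {Λ : Set (Space d)} {bc : BoundaryCondition} {u : L2 Λ}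
    (hu : MemV bc u) : MemH1 u := by
  cases bc with
  | robin α₀ => exact hu
  | dirichlet => exact fun i => hu.hasWeakPartial i

lemma IsContRep.eqOn {d : ℕ} {Λ : Set (Space d)} (hΛ : IsOpen Λ) {u : L2 Λ}
    {f : Space d → ℝ} (hf : IsContRep u f) : Set.EqOn (contRep u) f (closure Λ) := by
  have h : ∃ f, IsContRep u f := ⟨f, hf⟩
  have hc : IsContRep u (contRep u) := by
    rw [contRep, dif_pos h]
    exact h.choose_spec
  have h1 : Set.EqOn (contRep u) f Λ := Measure.eqOn_open_of_ae_eq (μ := volume)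
    (hc.2.symm.trans hf.2) hΛ (hc.1.mono subset_closure) (hf.1.mono subset_closure)
  exact h1.of_subset_closure hc.1 hf.1 subset_closure le_rfl

/-- The form is bilinear on `V_h`, so the operator `A_h(t)` exists. -/
theorem discreteA_spec {d : ℕ} {Λ : Set (Space d)} (hΛ : IsOpen Λ) (hb : Bornology.IsBounded Λ)
    {T : ℝ} {bc : BoundaryCondition} {co : Coefficients d} (hco : IsAdmissible Λ T bc co)
    (𝒯 : Triangulation Λ) {t : ℝ} (ht : t ∈ Set.Icc 0 T) (φ χ : feSpace bc 𝒯) :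
    inner ℝ (discreteA bc co 𝒯 t φ) χ = -form bc co t (φ : L2 Λ) (χ : L2 Λ) := by
  have hK : IsCompact (closure Λ) := hb.isCompact_closure
  have hwadd : ∀ (i : Fin d) (u v : feSpace bc 𝒯),
      weakPartial i ((u : L2 Λ) + (v : L2 Λ)) = weakPartial i (u : L2 Λ) + weakPartial i (v : L2 Λ) := by
    intro i u v
    obtain ⟨g, hg⟩ := u.2.1.memH1 i
    obtain ⟨k, hk⟩ := v.2.1.memH1 i
    rw [weakPartial_eq hΛ hg, weakPartial_eq hΛ hk, weakPartial_eq hΛ (hg.add hk)]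
  have hwsmul : ∀ (i : Fin d) (c : ℝ) (u : feSpace bc 𝒯),
      weakPartial i (c • (u : L2 Λ)) = c • weakPartial i (u : L2 Λ) := by
    intro i c u
    obtain ⟨g, hg⟩ := u.2.1.memH1 i
    rw [weakPartial_eq hΛ hg, weakPartial_eq hΛ (hg.smul c)]
  have hint : ∀ (κ : Space d → ℝ), ContinuousOn κ (closure Λ) → ∀ u v : L2 Λ,
      Integrable (fun x => κ x * (u x * v x)) (volume.restrict Λ) := by
    intro κ hκ u v
    obtain ⟨C, hC⟩ := hK.exists_bound_of_continuousOn hκ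
    refine Integrable.bdd_mul (c := C)
      (MemLp.integrable_mul (p := 2) (q := 2) (Lp.memLp u) (Lp.memLp v))
      ((hκ.mono subset_closure).aestronglyMeasurable hΛ.measurableSet) ?_
    filter_upwards [ae_restrict_mem hΛ.measurableSet] with x hx
    exact hC x (subset_closure hx)
  have hvol : ∀ u v : L2 Λ, volumeForm co t u v =
      (∑ i : Fin d, ∑ j : Fin d,
        ∫ x in Λ, co.q i j x t * (weakPartial i u x * weakPartial j v x))
      + (∑ i : Fin d, ∫ x in Λ, co.b i x t * (weakPartial i u x * v x))
      + ∫ x in Λ, co.c₀ * (u x * v x) := by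
    intro u v
    have iq : ∀ i j, Integrable (fun x => co.q i j x t * (weakPartial i u x * weakPartial j v x))
        (volume.restrict Λ) := fun i j => hint _ (hco.smooth_q i j t ht).continuousOn _ _
    have ib : ∀ i, Integrable (fun x => co.b i x t * (weakPartial i u x * v x))
        (volume.restrict Λ) := fun i => hint _ (hco.smooth_b i t ht).continuousOn _ _
    have ic : Integrable (fun x => co.c₀ * (u x * v x)) (volume.restrict Λ) :=
      hint _ continuousOn_const _ _
    simp only [volumeForm, mul_assoc]
    rw [integral_add, integral_add, integral_finsetSum, integral_finsetSum]
    · congr 2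
      refine Finset.sum_congr rfl fun i _ => ?_
      rw [integral_finsetSum _ fun j _ => iq i j]
    · exact fun i _ => ib i
    · exact fun i _ => integrable_finsetSum _ fun j _ => iq i j
    · exact integrable_finsetSum _ fun i _ => integrable_finsetSum _ fun j _ => iq i j
    · exact integrable_finsetSum _ fun i _ => ib i
    · exact (integrable_finsetSum _ fun i _ => integrable_finsetSum _ fun j _ => iq i j).add
        (integrable_finsetSum _ fun i _ => ib i)
    · exact ic
  have tadd : ∀ (κ : Space d → ℝ), ContinuousOn κ (closure Λ) → ∀ u v w : L2 Λ,
      ∫ x in Λ, κ x * ((u + v : L2 Λ) x * w x)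
        = (∫ x in Λ, κ x * (u x * w x)) + ∫ x in Λ, κ x * (v x * w x) := by
    intro κ hκ u v w
    rw [← integral_add (hint κ hκ u w) (hint κ hκ v w)]
    refine integral_congr_ae ?_
    filter_upwards [Lp.coeFn_add u v] with x hx
    rw [hx, Pi.add_apply]
    ring
  have tsmul : ∀ (κ : Space d → ℝ) (c : ℝ) (u w : L2 Λ),
      ∫ x in Λ, κ x * ((c • u : L2 Λ) x * w x) = c * ∫ x in Λ, κ x * (u x * w x) := by
    intro κ c u w
    rw [← integral_const_mul]
    refine integral_congr_ae ?_
    filter_upwards [Lp.coeFn_smul c u] with x hx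
    rw [hx, Pi.smul_apply, smul_eq_mul]
    ring
  have tcomm : ∀ (κ : Space d → ℝ) (u w : L2 Λ),
      ∫ x in Λ, κ x * (u x * w x) = ∫ x in Λ, κ x * (w x * u x) := by
    intro κ u w
    simp only [mul_comm (u _)]
  have tadd' : ∀ (κ : Space d → ℝ), ContinuousOn κ (closure Λ) → ∀ w u v : L2 Λ,
      ∫ x in Λ, κ x * (w x * (u + v : L2 Λ) x)
        = (∫ x in Λ, κ x * (w x * u x)) + ∫ x in Λ, κ x * (w x * v x) := by
    intro κ hκ w u v
    rw [tcomm, tadd κ hκ, tcomm κ u, tcomm κ v]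
  have tsmul' : ∀ (κ : Space d → ℝ) (c : ℝ) (w u : L2 Λ),
      ∫ x in Λ, κ x * (w x * (c • u : L2 Λ) x) = c * ∫ x in Λ, κ x * (w x * u x) := by
    intro κ c w u
    rw [tcomm, tsmul, tcomm]
  have cq := fun i j => (hco.smooth_q i j t ht).continuousOn
  have cb := fun i => (hco.smooth_b i t ht).continuousOn
  -- the boundary part
  have hrep : ∀ u : feSpace bc 𝒯, ∃ f, IsContRep (u : L2 Λ) f := fun u =>
    let ⟨f, hf, huf⟩ := u.2.2
    ⟨f, hf.1, huf⟩
  choose r hr using hrep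
  have hradd : ∀ u v : feSpace bc 𝒯, ∀ x ∈ closure Λ,
      contRep ((u + v : feSpace bc 𝒯) : L2 Λ) x
        = contRep (u : L2 Λ) x + contRep (v : L2 Λ) x := by
    intro u v x hx
    have : IsContRep ((u + v : feSpace bc 𝒯) : L2 Λ) (fun x => r u x + r v x) :=
      ⟨(hr u).1.add (hr v).1, (Lp.coeFn_add _ _).trans ((hr u).2.add (hr v).2)⟩
    rw [this.eqOn hΛ hx, (hr u).eqOn hΛ hx, (hr v).eqOn hΛ hx]
  have hrsmul : ∀ (c : ℝ) (u : feSpace bc 𝒯), ∀ x ∈ closure Λ,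
      contRep ((c • u : feSpace bc 𝒯) : L2 Λ) x = c * contRep (u : L2 Λ) x := by
    intro c u x hx
    have : IsContRep ((c • u : feSpace bc 𝒯) : L2 Λ) (fun x => c * r u x) :=
      ⟨continuousOn_const.mul (hr u).1, (Lp.coeFn_smul _ _).trans ((hr u).2.const_smul c)⟩
    rw [this.eqOn hΛ hx, (hr u).eqOn hΛ hx]
  have hbd : (∀ u v w : feSpace bc 𝒯,
        boundaryForm bc ((u + v : feSpace bc 𝒯) : L2 Λ) (w : L2 Λ)
          = boundaryForm bc (u : L2 Λ) (w : L2 Λ) + boundaryForm bc (v : L2 Λ) (w : L2 Λ)) ∧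
      (∀ (c : ℝ) (u w : feSpace bc 𝒯), boundaryForm bc ((c • u : feSpace bc 𝒯) : L2 Λ) (w : L2 Λ)
          = c * boundaryForm bc (u : L2 Λ) (w : L2 Λ)) ∧
      (∀ u w : feSpace bc 𝒯,
        boundaryForm bc (u : L2 Λ) (w : L2 Λ) = boundaryForm bc (w : L2 Λ) (u : L2 Λ)) := by
    cases hbc : bc with
    | dirichlet => simp [boundaryForm]
    | robin α₀ =>
      subst hbc
      simp only [boundaryForm]
      have hm : MeasurableSet (frontier Λ) := isClosed_frontier.measurableSet
      refine ⟨fun u v w => ?_, fun c u w => ?_, fun u w => ?_⟩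
      · by_cases h0 : α₀ = 0
        · simp [h0]
        have hfin := hco.finite_boundary α₀ rfl h0
        have hi : ∀ u : feSpace (.robin α₀) 𝒯, IntegrableOn
            (fun x => α₀ * contRep (u : L2 Λ) x * contRep (w : L2 Λ) x) (frontier Λ)
            (Measure.euclideanHausdorffMeasure (d - 1)) := by
          intro u
          have hc : ContinuousOn (fun x => α₀ * contRep (u : L2 Λ) x * contRep (w : L2 Λ) x)
              (closure Λ) :=
            (continuousOn_const.mul ((hr u).1.congr ((hr u).eqOn hΛ))).mul
              ((hr w).1.congr ((hr w).eqOn hΛ))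
          obtain ⟨C, hC⟩ := hK.exists_bound_of_continuousOn hc
          refine IntegrableOn.of_bound (C := C) hfin
            ((hc.mono frontier_subset_closure).aestronglyMeasurable hm) ?_
          filter_upwards [ae_restrict_mem hm] with x hx
          exact hC x (frontier_subset_closure hx)
        rw [← integral_add (hi u) (hi v)]
        refine setIntegral_congr_fun hm fun x hx => ?_
        simp only [hradd u v x (frontier_subset_closure hx)]
        ring
      · rw [← integral_const_mul]
        refine setIntegral_congr_fun hm fun x hx => ?_
        simp only [hrsmul c u x (frontier_subset_closure hx)]
        ring
      · congr 1
        funext x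
        ring
  obtain ⟨bd1, bd2, bd3⟩ := hbd
  let β : feSpace bc 𝒯 →ₗ[ℝ] feSpace bc 𝒯 →ₗ[ℝ] ℝ := LinearMap.mk₂ ℝ
    (fun u v => -form bc co t (u : L2 Λ) (v : L2 Λ))
    (by
      intro u v w
      simp only [form, bd1 u v w, hvol]
      simp only [Submodule.coe_add, hwadd, tadd _ (cq _ _), tadd _ (cb _),
        tadd _ continuousOn_const, Finset.sum_add_distrib]
      ring)
    (by
      intro c u w
      simp only [form, bd2 c u w, hvol]
      simp only [Submodule.coe_smul, hwsmul, tsmul, ← Finset.mul_sum, smul_eq_mul]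
      ring)
    (by
      intro w u v
      simp only [form, bd3 w, bd1 u v w, hvol]
      simp only [Submodule.coe_add, hwadd, tadd' _ (cq _ _), tadd' _ (cb _),
        tadd' _ continuousOn_const, Finset.sum_add_distrib]
      ring)
    (by
      intro c w u
      simp only [form, bd3 w, bd2 c u w, hvol]
      simp only [Submodule.coe_smul, hwsmul, tsmul', ← Finset.mul_sum, smul_eq_mul]
      ring)
  have hex : ∃ B : DiscreteOp bc 𝒯, ∀ φ χ : feSpace bc 𝒯,
      inner ℝ (B φ) χ = -form bc co t (φ : L2 Λ) (χ : L2 Λ) := by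
    let L : feSpace bc 𝒯 →ₗ[ℝ] feSpace bc 𝒯 :=
      ((InnerProductSpace.toDual ℝ (feSpace bc 𝒯)).symm.toLinearEquiv.toLinearMap).comp
        ((LinearMap.toContinuousLinearMap (𝕜 := ℝ) (E := feSpace bc 𝒯)
          (F' := ℝ)).toLinearMap.comp β)
    refine ⟨LinearMap.toContinuousLinearMap L, fun φ χ => ?_⟩
    exact InnerProductSpace.toDual_symm_apply
  rw [discreteA, dif_pos hex]
  exact hex.choose_spec φ χ

/-- `J = P_h ∂F/∂u (t, w)` as an operator on `V_h`. -/
def discreteJ {d : ℕ} {Λ : Set (Space d)} (bc : BoundaryCondition) (𝒯 : Triangulation Λ)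
    (F : ℝ → L2 Λ → L2 Λ) (t : ℝ) (w : feSpace bc 𝒯) : DiscreteOp bc 𝒯 :=
  (proj bc 𝒯).comp ((fderiv ℝ (F t) (w : L2 Λ)).comp (feSpace bc 𝒯).subtypeL)

/-- The midpoint `t_m + Δt/2`, where `t_m = m Δt`. -/
def midTime (dt : ℝ) (m : ℕ) : ℝ := m * dt + dt / 2

/-- The exponential `e^B` of a bounded operator. -/
def opExp {X : Type*} [NormedAddCommGroup X] [NormedSpace ℝ X] (B : X →L[ℝ] X) : X →L[ℝ] X :=
  NormedSpace.exp B

/-- `φ₁(Δt B) = (1/Δt) ∫₀^{Δt} e^{B(Δt-s)} ds`. -/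
def phiOne {X : Type*} [NormedAddCommGroup X] [NormedSpace ℝ X] (dt : ℝ) (B : X →L[ℝ] X) :
    X →L[ℝ] X :=
  (1 / dt) • ∫ s in (0 : ℝ)..dt, opExp ((dt - s) • B)

/-- One step of the Magnus-Rosenbrock method, from `w = u^h_m` to `u^h_{m+1}`. -/
def step {d : ℕ} {Λ : Set (Space d)} (bc : BoundaryCondition) (co : Coefficients d)
    (𝒯 : Triangulation Λ) (F : ℝ → L2 Λ → L2 Λ) (T dt : ℝ) (m : ℕ) (w : feSpace bc 𝒯) :
    feSpace bc 𝒯 :=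
  let τ := midTime dt m
  let J := discreteJ bc 𝒯 F τ w
  let B := discreteA bc co 𝒯 τ + J
  let a := proj bc 𝒯 (derivWithin (fun s => F s (w : L2 Λ)) (Set.Icc 0 T) τ)
  let G := proj bc 𝒯 (F τ (w : L2 Λ)) - J w - τ • a
  opExp (dt • B) w + dt • phiOne dt B (τ • a) + dt • phiOne dt B G

/-- The numerical approximations `u^h_m`, with `u^h_0 = P_h u₀`. -/
def approx {d : ℕ} {Λ : Set (Space d)} (bc : BoundaryCondition) (co : Coefficients d)
    (𝒯 : Triangulation Λ) (F : ℝ → L2 Λ → L2 Λ) (u₀ : L2 Λ) (T dt : ℝ) : ℕ → feSpace bc 𝒯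
  | 0 => proj bc 𝒯 u₀
  | m + 1 => step bc co 𝒯 F T dt m (approx bc co 𝒯 F u₀ T dt m)

/-- `e^{Δt (A_{h,j} + J^h_j)}`. -/
def stepExp {d : ℕ} {Λ : Set (Space d)} (bc : BoundaryCondition) (co : Coefficients d)
    (𝒯 : Triangulation Λ) (F : ℝ → L2 Λ → L2 Λ) (u₀ : L2 Λ) (T dt : ℝ) (j : ℕ) :
    DiscreteOp bc 𝒯 :=
  opExp (dt • (discreteA bc co 𝒯 (midTime dt j)
    + discreteJ bc 𝒯 F (midTime dt j) (approx bc co 𝒯 F u₀ T dt j)))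

/-- The ordered product `H_m H_{m-1} ⋯ H_k` (the identity if `m < k`). -/
def orderedProd {R : Type*} [Monoid R] (H : ℕ → R) (k m : ℕ) : R :=
  ((List.range' k (m + 1 - k)).map H).reverse.prod

/-- The fractional power `(-A)^γ`, `γ ≥ 0`: the identity for `γ = 0`, and for `γ > 0` the inverse of
`(-A)^{-γ} = Γ(γ)⁻¹ ∫₀^∞ s^{γ-1} e^{sA} ds`. -/
def negPow {X : Type*} [NormedAddCommGroup X] [NormedSpace ℝ X] (A : X →L[ℝ] X) (γ : ℝ) :
    X →L[ℝ] X :=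
  if γ = 0 then 1
  else Ring.inverse
    ((Real.Gamma γ)⁻¹ • ∫ s in Set.Ioi (0 : ℝ), s ^ (γ - 1) • opExp (s • A))

end MagnusRosenbrock

end

/-!
The estimate is a statement about bounded operators on a finite dimensional Hilbert space, with
constants that do not see the space. In the energy norm `p(v)² = ‖v‖₁² + |β(v,v)|` the forms of
`-A_h(t)` are coercive and bounded (`exists_isSectorial_discreteA`) and Lipschitz continuous in `t`
(`exists_discreteA_lipschitz`), uniformly in the triangulation. Only weak Lipschitz continuity is
assumed; it becomes a norm estimate by the uniform boundedness principle on `V`, realised as a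
closed space of pairs `(u, ∇u)`. The operators `J` enter only through the bound `‖J‖ ≤ K₃`, so
nothing about the numerical approximations themselves is needed.

For a single sectorial operator `A`, the quantity `t²‖u'‖² + (C/2λ)²‖u‖²` decreases along
`u' = Au`, which gives `‖A e^{tA}‖ ≤ C/(2λt)` without complex analysis
(`IsSectorial.norm_mul_opExp_le`). Euler's beta integral gives
`(-A)^γ = (-A) (-A)^{-(1-γ)}` (`IsSectorial.negPow_eq`), and the two together yield
`‖e^{rA} (-A)^γ‖ ≤ c r^{-γ}` and `‖A e^{rA} (-A)^γ‖ ≤ c r^{-γ-1}`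
(`IsSectorial.hasSmoothing_negPow`), hence also `p(e^{rA} (-A)^γ x) ≤ c' r^{-γ-1/2} ‖x‖`.

The product is compared with the semigroup of the frozen generator `A₀ = A_{h,k}`. Let
`w(r) = e^{rA₀} (-A₀)^γ x`, and let `v` be the solution of the adjoint problem that starts from a
unit vector `z` at the final time and runs backwards. Then `⟨w, v⟩` is the matrix element of the
product at the initial time and that of `e^{tA₀} (-A₀)^γ` at the final time. Its derivative is at
most `L r p(w) p(v)` plus the contribution of `J`. Since `p(w)` is of order `r^{-γ-1/2}`, the first
term is at most `c r^{1-2γ} + λ p(v)²`, and `λ p(v)²` is what the derivative of `‖v‖²/2` supplies.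
So `⟨w, v⟩ + ‖v‖²/2` plus an explicit function of `r`, bounded because `γ < 1`, is increasing
(`inner_add_defect_step_le`), and comparing the two end points proves the estimate
(`norm_orderedProd_mul_negPow_le`).
-/

namespace MagnusRosenbrock

/-! ### Semigroups of sectorial operators -/

section Semigroup

variable {X : Type*} [NormedAddCommGroup X] [InnerProductSpace ℝ X]

/-- `A` is the negative of the operator of a bilinear form that is coercive, with constant `lam`,
and bounded, with constant `C`, in an energy norm `p` that dominates the norm of `X`. Only the
values of `p` matter, so `p` need not be a norm. -/
structure IsSectorial (p : X → ℝ) (lam C : ℝ) (A : X →L[ℝ] X) : Prop where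
  lam_pos : 0 < lam
  nonneg : 0 ≤ C
  norm_le : ∀ v, ‖v‖ ≤ p v
  coercive : ∀ v, lam * p v ^ 2 ≤ -inner ℝ (A v) v
  bounded : ∀ u v, |inner ℝ (A u) v| ≤ C * (p u * p v)

lemma IsSectorial.energy_nonneg {p : X → ℝ} {lam C : ℝ} {A : X →L[ℝ] X}
    (h : IsSectorial p lam C A) (v : X) : 0 ≤ p v :=
  (norm_nonneg v).trans (h.norm_le v)

lemma IsSectorial.inner_self_le {p : X → ℝ} {lam C : ℝ} {A : X →L[ℝ] X}
    (h : IsSectorial p lam C A) (v : X) : inner ℝ (A v) v ≤ -lam * ‖v‖ ^ 2 := by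
  have h1 := h.coercive v
  have h2 : lam * ‖v‖ ^ 2 ≤ lam * p v ^ 2 := by
    have := h.lam_pos
    have := h.norm_le v
    gcongr
  linarith

lemma opExp_zero : opExp (0 : X →L[ℝ] X) = 1 := NormedSpace.exp_zero

lemma commute_opExp (A : X →L[ℝ] X) (t : ℝ) : Commute A (opExp (t • A)) :=
  ((Commute.refl A).smul_right t).exp_right

variable [CompleteSpace X]

lemma hasDerivAt_opExp (A : X →L[ℝ] X) (t : ℝ) :
    HasDerivAt (fun t : ℝ => opExp (t • A)) (A * opExp (t • A)) t :=
  hasDerivAt_exp_smul_const' A t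

lemma hasDerivAt_opExp_apply (A : X →L[ℝ] X) (x : X) (t : ℝ) :
    HasDerivAt (fun t : ℝ => opExp (t • A) x) (A (opExp (t • A) x)) t := by
  simpa using (hasDerivAt_opExp A t).clm_apply (hasDerivAt_const t x)

lemma opExp_add_smul (A : X →L[ℝ] X) (s t : ℝ) :
    opExp ((s + t) • A) = opExp (s • A) * opExp (t • A) := by
  let _ : NormedAlgebra ℚ (X →L[ℝ] X) := NormedAlgebra.restrictScalars ℚ ℝ _
  rw [add_smul]
  exact NormedSpace.exp_add_of_commute (((Commute.refl A).smul_left s).smul_right t)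

lemma continuous_opExp (A : X →L[ℝ] X) : Continuous (fun t : ℝ => opExp (t • A)) :=
  continuous_iff_continuousAt.2 fun t => (hasDerivAt_opExp A t).continuousAt

/-- The semigroup of an `κ`-dissipative operator grows at most like `e^{κt}`. -/
lemma norm_opExp_apply_le {B : X →L[ℝ] X} {κ : ℝ} (h : ∀ v, inner ℝ (B v) v ≤ κ * ‖v‖ ^ 2)
    {t : ℝ} (ht : 0 ≤ t) (x : X) : ‖opExp (t • B) x‖ ≤ Real.exp (κ * t) * ‖x‖ := by
  have hd : ∀ s : ℝ, HasDerivAt (fun s : ℝ => Real.exp (-(2 * κ) * s) * ‖opExp (s • B) x‖ ^ 2)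
      (Real.exp (-(2 * κ) * s) * (-(2 * κ)) * ‖opExp (s • B) x‖ ^ 2
        + Real.exp (-(2 * κ) * s) * (2 * inner ℝ (opExp (s • B) x) (B (opExp (s • B) x)))) s := by
    intro s
    have h1 : HasDerivAt (fun s : ℝ => Real.exp (-(2 * κ) * s))
        (Real.exp (-(2 * κ) * s) * (-(2 * κ))) s := by
      simpa using ((hasDerivAt_id s).const_mul (-(2 * κ))).exp
    exact h1.mul (hasDerivAt_opExp_apply B x s).norm_sq
  have hanti := antitone_of_hasDerivAt_nonpos hd fun s => by
    change _ ≤ (0 : ℝ)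
    have := h (opExp (s • B) x)
    rw [real_inner_comm] at this
    have e := Real.exp_pos (-(2 * κ) * s)
    nlinarith
  have h0 := hanti ht
  simp only [zero_smul, opExp_zero, mul_zero, Real.exp_zero, one_mul,
    one_apply_eq_self] at h0
  have e : Real.exp (-(2 * κ) * t) * Real.exp (κ * t) ^ 2 = 1 := by
    rw [← Real.exp_nat_mul, ← Real.exp_add]
    convert Real.exp_zero using 2
    push_cast
    ring
  refine abs_le_of_sq_le_sq' ?_ (by positivity) |>.2
  have p2 : 0 < Real.exp (κ * t) ^ 2 := by positivity
  calc ‖opExp (t • B) x‖ ^ 2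
      = Real.exp (κ * t) ^ 2 * (Real.exp (-(2 * κ) * t) * ‖opExp (t • B) x‖ ^ 2) := by
        rw [← mul_assoc, mul_comm (Real.exp (κ * t) ^ 2), e, one_mul]
    _ ≤ Real.exp (κ * t) ^ 2 * ‖x‖ ^ 2 := by gcongr
    _ = _ := by ring

lemma IsSectorial.norm_opExp_le {p : X → ℝ} {lam C : ℝ} {A : X →L[ℝ] X}
    (h : IsSectorial p lam C A) {t : ℝ} (ht : 0 ≤ t) :
    ‖opExp (t • A)‖ ≤ Real.exp (-lam * t) :=
  ContinuousLinearMap.opNorm_le_bound _ (Real.exp_pos _).le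
    fun x => norm_opExp_apply_le h.inner_self_le ht x

lemma IsSectorial.norm_opExp_le_one {p : X → ℝ} {lam C : ℝ} {A : X →L[ℝ] X}
    (h : IsSectorial p lam C A) {t : ℝ} (ht : 0 ≤ t) : ‖opExp (t • A)‖ ≤ 1 :=
  (h.norm_opExp_le ht).trans (Real.exp_le_one_iff.2 (by nlinarith [h.lam_pos]))

/-- Parabolic smoothing, by an energy argument that does not need a complex sector: along
`u(t) = e^{tA}x` the quantity `t²‖u'‖² + (C/2λ)²‖u‖²` decreases, since the term `2t‖u'‖²` of its
derivative is at most `2tC p(u) p(u')`, which the dissipation absorbs. -/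
lemma IsSectorial.norm_mul_opExp_le {p : X → ℝ} {lam C : ℝ} {A : X →L[ℝ] X}
    (h : IsSectorial p lam C A) {t : ℝ} (ht : 0 < t) :
    ‖A * opExp (t • A)‖ ≤ C / (2 * lam) / t := by
  have hl := h.lam_pos
  have hC := h.nonneg
  refine ContinuousLinearMap.opNorm_le_bound _ (by positivity) fun x => ?_
  set κ : ℝ := C / (2 * lam) with hκ
  have hκ0 : 0 ≤ κ := by positivity
  let u : ℝ → X := fun s => opExp (s • A) x
  have hu : ∀ s, HasDerivAt u (A (u s)) s := hasDerivAt_opExp_apply A x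
  have hd : ∀ s : ℝ, HasDerivAt (fun s : ℝ => s ^ 2 * ‖A (u s)‖ ^ 2 + κ ^ 2 * ‖u s‖ ^ 2)
      (2 * s * ‖A (u s)‖ ^ 2 + s ^ 2 * (2 * inner ℝ (A (u s)) (A (A (u s))))
        + κ ^ 2 * (2 * inner ℝ (u s) (A (u s)))) s := by
    intro s
    have h1 : HasDerivAt (fun s : ℝ => s ^ 2) (2 * s) s := by simpa using hasDerivAt_pow 2 s
    exact (h1.mul (A.hasFDerivAt.comp_hasDerivAt s (hu s)).norm_sq).add
      ((hu s).norm_sq.const_mul (κ ^ 2))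
  have hanti := antitone_of_hasDerivAt_nonpos hd fun s => by
    change _ ≤ (0 : ℝ)
    have c1 := h.coercive (A (u s))
    have c2 := h.coercive (u s)
    have b := h.bounded (u s) (A (u s))
    rw [real_inner_self_eq_norm_sq, abs_of_nonneg (by positivity)] at b
    rw [real_inner_comm] at c1 c2
    have n1 := h.energy_nonneg (A (u s))
    have n2 := h.energy_nonneg (u s)
    have e1 : 2 * s * ‖A (u s)‖ ^ 2 ≤ 2 * (C * (p (u s) * (|s| * p (A (u s))))) := by
      calc 2 * s * ‖A (u s)‖ ^ 2 ≤ 2 * |s| * ‖A (u s)‖ ^ 2 := by gcongr; exact le_abs_self s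
        _ ≤ 2 * |s| * (C * (p (u s) * p (A (u s)))) := by gcongr
        _ = _ := by ring
    have hCκ : C = 2 * lam * κ := by rw [hκ]; field_simp
    have e2 : s ^ 2 * (lam * p (A (u s)) ^ 2) ≤ s ^ 2 * -inner ℝ (A (u s)) (A (A (u s))) := by
      gcongr
    have e3 : κ ^ 2 * (lam * p (u s) ^ 2) ≤ κ ^ 2 * -inner ℝ (u s) (A (u s)) := by
      gcongr
    have e4 : 0 ≤ lam * (|s| * p (A (u s)) - κ * p (u s)) ^ 2 := by positivity
    have e5 : (|s| * p (A (u s))) ^ 2 = s ^ 2 * p (A (u s)) ^ 2 := by rw [mul_pow, sq_abs]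
    have e6 : lam * (|s| * p (A (u s)) - κ * p (u s)) ^ 2 = lam * (|s| * p (A (u s))) ^ 2
        - 2 * lam * κ * (p (u s) * (|s| * p (A (u s)))) + κ ^ 2 * (lam * p (u s) ^ 2) := by ring
    rw [e5] at e6
    rw [hCκ] at e1
    linarith
  have h0 := hanti ht.le
  simp only [u, zero_smul, opExp_zero, one_apply_eq_self, zero_pow two_ne_zero, zero_mul,
    zero_add] at h0
  have h1 : (t * ‖A (opExp (t • A) x)‖) ^ 2 ≤ (κ * ‖x‖) ^ 2 := by
    have : 0 ≤ κ ^ 2 * ‖opExp (t • A) x‖ ^ 2 := by positivity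
    nlinarith
  have h2 := (abs_le_of_sq_le_sq' h1 (by positivity)).2
  rw [mul_apply_eq_comp, div_mul_eq_mul_div, le_div_iff₀ ht]
  linarith

end Semigroup

/-! ### Fractional powers -/

section FractionalPower

variable {X : Type*} [NormedAddCommGroup X] [InnerProductSpace ℝ X] [CompleteSpace X]
  {p : X → ℝ} {lam C : ℝ} {A : X →L[ℝ] X}

/-- `Γ(γ) (-A)^{-γ}`, the integral in the definition of the fractional powers. -/
noncomputable def gammaIntegral (A : X →L[ℝ] X) (γ : ℝ) : X →L[ℝ] X :=
  ∫ s in Set.Ioi (0 : ℝ), s ^ (γ - 1) • opExp (s • A)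

lemma IsSectorial.integrableOn_rpow_smul_opExp (h : IsSectorial p lam C A) {γ : ℝ} (hγ : 0 < γ) :
    IntegrableOn (fun s : ℝ => s ^ (γ - 1) • opExp (s • A)) (Set.Ioi 0) := by
  have hi := integrableOn_rpow_mul_exp_neg_mul_rpow (p := 1) (s := γ - 1) (b := lam) (by linarith)
    one_pos h.lam_pos
  refine Integrable.mono' hi ?_ ?_
  · refine ContinuousOn.aestronglyMeasurable (fun s hs => ?_) measurableSet_Ioi
    exact ((Real.continuousAt_rpow_const s _ (Or.inl (ne_of_gt hs))).smul
      (continuous_opExp A).continuousAt).continuousWithinAt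
  · filter_upwards [ae_restrict_mem measurableSet_Ioi] with s hs
    have hs : 0 < s := hs
    rw [norm_smul, Real.norm_of_nonneg (by positivity), Real.rpow_one]
    gcongr
    exact h.norm_opExp_le hs.le

lemma IsSectorial.integrableOn_opExp (h : IsSectorial p lam C A) :
    IntegrableOn (fun s : ℝ => opExp (s • A)) (Set.Ioi 0) := by
  simpa using h.integrableOn_rpow_smul_opExp one_pos

/-- `∫₀^∞ e^{sA} ds = (-A)⁻¹`. -/
lemma IsSectorial.mul_integral_opExp (h : IsSectorial p lam C A) :
    A * ∫ s in Set.Ioi (0 : ℝ), opExp (s • A) = -1 := by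
  have ht : Tendsto (fun s : ℝ => opExp (s • A)) atTop (𝓝 0) := by
    have hl := h.lam_pos
    have he : Tendsto (fun s : ℝ => Real.exp (-lam * s)) atTop (𝓝 0) :=
      Real.tendsto_exp_atBot.comp (tendsto_id.const_mul_atTop_of_neg (by linarith))
    refine squeeze_zero_norm' ?_ he
    filter_upwards [eventually_ge_atTop 0] with s hs using h.norm_opExp_le hs
  have h1 := integral_Ioi_of_hasDerivAt_of_tendsto' (a := 0)
    (fun s _ => hasDerivAt_opExp A s) (h.integrableOn_opExp.const_mul A) ht
  rw [integral_const_mul_of_integrable h.integrableOn_opExp] at h1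
  rw [h1, zero_smul, opExp_zero, zero_sub]

lemma IsSectorial.mul_gammaIntegral (h : IsSectorial p lam C A) {γ : ℝ} (hγ : 0 < γ)
    (B : X →L[ℝ] X) :
    B * gammaIntegral A γ = ∫ s in Set.Ioi (0 : ℝ), s ^ (γ - 1) • (B * opExp (s • A)) := by
  rw [gammaIntegral, ← integral_const_mul_of_integrable (h.integrableOn_rpow_smul_opExp hγ)]
  simp only [mul_smul_comm]

lemma IsSectorial.commute_gammaIntegral (h : IsSectorial p lam C A) {γ : ℝ} (hγ : 0 < γ) :
    Commute A (gammaIntegral A γ) := by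
  rw [commute_iff_eq, h.mul_gammaIntegral hγ, gammaIntegral,
    ← integral_mul_const_of_integrable (h.integrableOn_rpow_smul_opExp hγ)]
  simp only [smul_mul_assoc, (commute_opExp A _).eq]

/-- Euler's beta integral on `[0, a]` for the exponents `γ` and `1 - γ`; it does not depend
on `a`. -/
lemma integral_rpow_mul_rpow_sub {γ : ℝ} (h0 : 0 < γ) (h1 : γ < 1) {a : ℝ} (ha : 0 < a) :
    ∫ t in (0 : ℝ)..a, t ^ (γ - 1) * (a - t) ^ ((1 - γ) - 1)
      = Real.Gamma γ * Real.Gamma (1 - γ) := by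
  have e := Complex.betaIntegral_scaled (γ : ℂ) ((1 - γ : ℝ) : ℂ) ha
  have g := Complex.Gamma_mul_Gamma_eq_betaIntegral (s := (γ : ℂ)) (t := ((1 - γ : ℝ) : ℂ))
    (by simpa using h0) (by simpa using h1)
  have s1 : (γ : ℂ) + ((1 - γ : ℝ) : ℂ) = 1 := by push_cast; ring
  rw [s1, Complex.Gamma_one, one_mul] at g
  rw [s1, sub_self, Complex.cpow_zero, one_mul, ← g, Complex.Gamma_ofReal,
    Complex.Gamma_ofReal] at e
  have e2 : ∫ t in (0 : ℝ)..a, (t : ℂ) ^ ((γ : ℂ) - 1) * ((a : ℂ) - t) ^ (((1 - γ : ℝ) : ℂ) - 1)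
      = ∫ t in (0 : ℝ)..a, ((t ^ (γ - 1) * (a - t) ^ ((1 - γ) - 1) : ℝ) : ℂ) := by
    refine intervalIntegral.integral_congr fun t ht => ?_
    rw [Set.uIcc_of_le ha.le] at ht
    simp only [Complex.ofReal_mul]
    rw [Complex.ofReal_cpow ht.1, Complex.ofReal_cpow (sub_nonneg.2 ht.2)]
    push_cast
    ring
  rw [e2, intervalIntegral.integral_ofReal] at e
  exact_mod_cast e

/-- `(-A)^{-γ} (-A)^{-(1-γ)} = (-A)⁻¹`: the product of the two integrals is the integral of their
convolution, in which the beta integral splits off. -/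
lemma IsSectorial.gammaIntegral_mul_gammaIntegral (h : IsSectorial p lam C A) {γ : ℝ}
    (h0 : 0 < γ) (h1 : γ < 1) :
    gammaIntegral A γ * gammaIntegral A (1 - γ)
      = (Real.Gamma γ * Real.Gamma (1 - γ)) • ∫ s in Set.Ioi (0 : ℝ), opExp (s • A) := by
  have hc := integral_posConvolution (h.integrableOn_rpow_smul_opExp h0)
    (h.integrableOn_rpow_smul_opExp (sub_pos.2 h1)) (ContinuousLinearMap.mul ℝ (X →L[ℝ] X))
  rw [ContinuousLinearMap.mul_apply'] at hc
  rw [gammaIntegral, gammaIntegral, ← hc, ← integral_smul]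
  refine setIntegral_congr_fun measurableSet_Ioi fun x hx => ?_
  have e : ∀ t : ℝ, ContinuousLinearMap.mul ℝ (X →L[ℝ] X) (t ^ (γ - 1) • opExp (t • A))
      ((x - t) ^ ((1 - γ) - 1) • opExp ((x - t) • A))
      = (t ^ (γ - 1) * (x - t) ^ ((1 - γ) - 1)) • opExp (x • A) := by
    intro t
    rw [ContinuousLinearMap.mul_apply', smul_mul_smul_comm, ← opExp_add_smul, add_sub_cancel]
  simp only [e]
  rw [intervalIntegral.integral_smul_const, integral_rpow_mul_rpow_sub h0 h1 hx]

/-- `(-A)^γ = (-A) (-A)^{-(1-γ)}`. In particular the operator whose inverse defines `(-A)^γ` is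
invertible. -/
lemma IsSectorial.negPow_eq (h : IsSectorial p lam C A) {γ : ℝ} (h0 : 0 < γ) (h1 : γ < 1) :
    negPow A γ = -((Real.Gamma (1 - γ))⁻¹ • (A * gammaIntegral A (1 - γ))) := by
  have g1 := Real.Gamma_pos_of_pos h0
  have g2 := Real.Gamma_pos_of_pos (sub_pos.2 h1)
  have hP : gammaIntegral A γ * (A * gammaIntegral A (1 - γ))
      = -((Real.Gamma γ * Real.Gamma (1 - γ)) • 1) := by
    rw [← mul_assoc, ← (h.commute_gammaIntegral h0).eq, mul_assoc,
      h.gammaIntegral_mul_gammaIntegral h0 h1, mul_smul_comm, h.mul_integral_opExp, smul_neg]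
  have hQ : A * gammaIntegral A (1 - γ) * gammaIntegral A γ
      = -((Real.Gamma γ * Real.Gamma (1 - γ)) • 1) := by
    have := h.gammaIntegral_mul_gammaIntegral (sub_pos.2 h1) (sub_lt_self 1 h0)
    rw [sub_sub_cancel] at this
    rw [mul_assoc, this, mul_smul_comm, h.mul_integral_opExp, smul_neg, mul_comm (Real.Gamma γ)]
  let U : (X →L[ℝ] X)ˣ :=
    { val := (Real.Gamma γ)⁻¹ • gammaIntegral A γ
      inv := -((Real.Gamma (1 - γ))⁻¹ • (A * gammaIntegral A (1 - γ)))
      val_inv := by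
        rw [mul_neg, smul_mul_smul_comm, hP, smul_neg, neg_neg, smul_smul]
        convert one_smul ℝ _
        field_simp
      inv_val := by
        rw [neg_mul, smul_mul_smul_comm, hQ, smul_neg, neg_neg, smul_smul]
        convert one_smul ℝ _
        field_simp }
  rw [negPow, if_neg h0.ne']
  exact Ring.inverse_unit U

/-- `∫₀^∞ s^{-γ} / (r + s) ds` is of order `r^{-γ}`. The integrand is compared with `s^{-γ} / r`
for `s ≤ r` and with `s^{-γ-1}` for `s > r`. -/
lemma norm_integral_le_of_norm_le_rpow_div {E : Type*} [NormedAddCommGroup E] [NormedSpace ℝ E]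
    {γ : ℝ} (h0 : 0 < γ) (h1 : γ < 1) {c r : ℝ} (hc : 0 ≤ c) (hr : 0 < r) {f : ℝ → E}
    (hf : ∀ s, 0 < s → ‖f s‖ ≤ s ^ (-γ) * (c / (r + s))) :
    ‖∫ s in Set.Ioi (0 : ℝ), f s‖ ≤ c * (1 / (1 - γ) + 1 / γ) * r ^ (-γ) := by
  by_cases hi : IntegrableOn f (Set.Ioi 0)
  swap
  · rw [integral_undef hi, norm_zero]
    have : 0 < 1 - γ := sub_pos.2 h1
    positivity
  rw [← Set.Ioc_union_Ioi_eq_Ioi hr.le, setIntegral_union (Set.Ioc_disjoint_Ioi le_rfl)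
    measurableSet_Ioi (hi.mono_set Set.Ioc_subset_Ioi_self)
    (hi.mono_set (Set.Ioi_subset_Ioi hr.le))]
  refine (norm_add_le _ _).trans ?_
  have b1 : ‖∫ s in Set.Ioc 0 r, f s‖ ≤ c * (1 / (1 - γ)) * r ^ (-γ) := by
    have hint : IntegrableOn (fun s : ℝ => s ^ (-γ) * (c / r)) (Set.Ioc 0 r) :=
      ((intervalIntegrable_iff_integrableOn_Ioc_of_le hr.le).1
        (intervalIntegral.intervalIntegrable_rpow' (by linarith))).mul_const _
    refine (norm_integral_le_of_norm_le hint ?_).trans_eq ?_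
    · filter_upwards [ae_restrict_mem measurableSet_Ioc] with s hs
      have hs0 : 0 < s := hs.1
      refine (hf s hs0).trans ?_
      gcongr
      linarith
    · rw [integral_mul_const, ← intervalIntegral.integral_of_le hr.le,
        integral_rpow (Or.inl (by linarith)), Real.zero_rpow (by linarith), sub_zero,
        Real.rpow_add hr, Real.rpow_one]
      have : -γ + 1 ≠ 0 := by linarith
      have : 1 - γ ≠ 0 := by linarith
      field_simp
      ring
  have b2 : ‖∫ s in Set.Ioi r, f s‖ ≤ c * (1 / γ) * r ^ (-γ) := by
    have hint : IntegrableOn (fun s : ℝ => c * s ^ (-γ - 1)) (Set.Ioi r) :=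
      (integrableOn_Ioi_rpow_of_lt (by linarith) hr).const_mul _
    refine (norm_integral_le_of_norm_le hint ?_).trans_eq ?_
    · filter_upwards [ae_restrict_mem measurableSet_Ioi] with s hs
      have hs0 : 0 < s := hr.trans hs
      refine (hf s hs0).trans ?_
      rw [Real.rpow_sub_one hs0.ne', mul_div_assoc', mul_div_assoc', mul_comm c]
      gcongr
      linarith
    · rw [integral_const_mul, integral_Ioi_rpow_of_lt (by linarith) hr, sub_add_cancel]
      field_simp
  calc _ ≤ _ := add_le_add b1 b2
    _ = _ := by ring

/-- The orbit of `y` under the semigroup of `A` obeys, with constant `c`, the smoothing estimates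
that hold for vectors `y = (-A)^γ x`. -/
def HasSmoothing (A : X →L[ℝ] X) (γ c : ℝ) (y : X) : Prop :=
  ∀ r : ℝ, 0 < r → ‖opExp (r • A) y‖ ≤ c * r ^ (-γ) ∧ ‖A (opExp (r • A) y)‖ ≤ c * r ^ (-γ - 1)

lemma IsSectorial.norm_opExp_mul_negPow_le (h : IsSectorial p lam C A) {γ : ℝ} (h0 : 0 ≤ γ)
    (h1 : γ < 1) {r : ℝ} (hr : 0 < r) :
    ‖opExp (r • A) * negPow A γ‖ ≤ (1 + (Real.Gamma (1 - γ))⁻¹ *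
      (C / (2 * lam) * (1 / (1 - γ) + 1 / γ))) * r ^ (-γ) := by
  have hl := h.lam_pos
  have hC := h.nonneg
  have h1' : 0 < 1 - γ := sub_pos.2 h1
  have g2 := Real.Gamma_pos_of_pos h1'
  rcases h0.eq_or_lt with rfl | h0
  · rw [negPow, if_pos rfl, mul_one, neg_zero, Real.rpow_zero, mul_one]
    exact (h.norm_opExp_le_one hr.le).trans (le_add_of_nonneg_right (by positivity))
  rw [h.negPow_eq h0 h1, mul_neg, norm_neg, mul_smul_comm, norm_smul,
    Real.norm_of_nonneg (by positivity), ← mul_assoc, ← (commute_opExp A r).eq,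
    h.mul_gammaIntegral h1']
  have := norm_integral_le_of_norm_le_rpow_div h0 h1 (c := C / (2 * lam)) (by positivity) hr
    (f := fun s : ℝ => s ^ (1 - γ - 1) • (A * opExp (r • A) * opExp (s • A))) fun s hs => by
      rw [mul_assoc, ← opExp_add_smul, norm_smul, Real.norm_of_nonneg (by positivity),
        show 1 - γ - 1 = -γ by ring]
      gcongr
      exact h.norm_mul_opExp_le (by positivity)
  calc _ ≤ (Real.Gamma (1 - γ))⁻¹ * (C / (2 * lam) * (1 / (1 - γ) + 1 / γ) * r ^ (-γ)) := by
        gcongr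
    _ ≤ _ := by
        have : 0 < r ^ (-γ) := by positivity
        nlinarith

/-- The constant in the smoothing estimates of `(-A)^γ`. -/
noncomputable def smoothingConst (lam C γ : ℝ) : ℝ :=
  (1 + C / lam) * (2 * (1 + (Real.Gamma (1 - γ))⁻¹ * (C / (2 * lam) * (1 / (1 - γ) + 1 / γ))))

lemma smoothingConst_nonneg {lam C γ : ℝ} (hl : 0 < lam) (hC : 0 ≤ C) (h0 : 0 ≤ γ) (h1 : γ < 1) :
    0 ≤ smoothingConst lam C γ := by
  have h1' : 0 < 1 - γ := sub_pos.2 h1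
  have g2 := Real.Gamma_pos_of_pos h1'
  unfold smoothingConst
  positivity

lemma IsSectorial.hasSmoothing_negPow (h : IsSectorial p lam C A) {γ : ℝ} (h0 : 0 ≤ γ)
    (h1 : γ < 1) (x : X) :
    HasSmoothing A γ (smoothingConst lam C γ * ‖x‖) (negPow A γ x) := by
  intro r hr
  have hl := h.lam_pos
  have hC := h.nonneg
  have h1' : 0 < 1 - γ := sub_pos.2 h1
  have g2 := Real.Gamma_pos_of_pos h1'
  set D := 1 + (Real.Gamma (1 - γ))⁻¹ * (C / (2 * lam) * (1 / (1 - γ) + 1 / γ)) with hD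
  have hD0 : 0 ≤ D := by positivity
  have hs : smoothingConst lam C γ = (1 + C / lam) * (2 * D) := rfl
  have b : ∀ r : ℝ, 0 < r → ‖opExp (r • A) * negPow A γ‖ ≤ D * r ^ (-γ) :=
    fun r hr => h.norm_opExp_mul_negPow_le h0 h1 hr
  have hr' : 0 < r ^ (-γ) := by positivity
  have hCl : 0 ≤ C / lam := by positivity
  constructor
  · calc ‖opExp (r • A) (negPow A γ x)‖ ≤ D * r ^ (-γ) * ‖x‖ :=
          ((opExp (r • A) * negPow A γ).le_opNorm x).trans (by gcongr; exact b r hr)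
      _ ≤ (1 + C / lam) * (2 * D) * r ^ (-γ) * ‖x‖ := by
          gcongr
          nlinarith
      _ = _ := by rw [hs]; ring
  · -- half of the time is spent on smoothing by `A`, the other half on `(-A)^γ`
    have hh : 0 < r / 2 := half_pos hr
    have e : A (opExp (r • A) (negPow A γ x))
        = (A * opExp ((r / 2) • A)) ((opExp ((r / 2) • A) * negPow A γ) x) := by
      conv_lhs => rw [← add_halves r, opExp_add_smul]
      rfl
    have h2 : (r / 2) ^ (-γ) ≤ 2 * r ^ (-γ) := by
      rw [Real.div_rpow hr.le (by norm_num), Real.rpow_neg (by norm_num : (0 : ℝ) ≤ 2), div_inv_eq_mul,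
        mul_comm]
      gcongr
      calc (2 : ℝ) ^ γ ≤ 2 ^ (1 : ℝ) := Real.rpow_le_rpow_of_exponent_le (by norm_num) h1.le
        _ = 2 := Real.rpow_one 2
    rw [e]
    calc _ ≤ C / (2 * lam) / (r / 2) * (D * (2 * r ^ (-γ)) * ‖x‖) := by
          refine ContinuousLinearMap.le_of_opNorm_le_of_le _ (h.norm_mul_opExp_le hh)
            (ContinuousLinearMap.le_of_opNorm_le _ ((b _ hh).trans ?_) x)
          gcongr
      _ = C / lam * (2 * D) * ‖x‖ * r ^ (-γ - 1) := by
          rw [Real.rpow_sub_one hr.ne']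
          field_simp
      _ ≤ (1 + C / lam) * (2 * D) * ‖x‖ * r ^ (-γ - 1) := by
          gcongr
          linarith
      _ = _ := by rw [hs]

end FractionalPower

/-! ### Products of exponentials -/

section OrderedProduct

lemma orderedProd_succ_self {R : Type*} [Monoid R] (H : ℕ → R) (m : ℕ) :
    orderedProd H (m + 1) m = 1 := by
  simp [orderedProd]

lemma orderedProd_eq_mul {R : Type*} [Monoid R] (H : ℕ → R) {j m : ℕ} (hj : j ≤ m) :
    orderedProd H j m = orderedProd H (j + 1) m * H j := by
  rw [orderedProd, orderedProd, show m + 1 - j = (m + 1 - (j + 1)) + 1 by omega, List.range'_succ]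
  simp

variable {X : Type*} [NormedAddCommGroup X] [InnerProductSpace ℝ X]
  {p : X → ℝ} {lam C : ℝ}

lemma HasSmoothing.energy_sq_le {A : X →L[ℝ] X} (h : IsSectorial p lam C A) {γ c : ℝ}
    (hc : 0 ≤ c) {y : X} (hy : HasSmoothing A γ c y) {r : ℝ} (hr : 0 < r) :
    lam * p (opExp (r • A) y) ^ 2 ≤ c ^ 2 * r ^ (-γ) * r ^ (-γ - 1) := by
  obtain ⟨h1, h2⟩ := hy r hr
  calc _ ≤ -inner ℝ (A (opExp (r • A) y)) (opExp (r • A) y) := h.coercive _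
    _ ≤ ‖A (opExp (r • A) y)‖ * ‖opExp (r • A) y‖ :=
        (neg_le_abs _).trans (abs_real_inner_le_norm _ _)
    _ ≤ (c * r ^ (-γ - 1)) * (c * r ^ (-γ)) := by gcongr
    _ = _ := by ring

variable [CompleteSpace X]

/-- The accumulated error of comparing, up to time `r`, the propagator with the semigroup of a
frozen generator. Its derivative is `L² c² r^{1-2γ} / (4 lam²) + K c D r^{-γ} + K D²`. -/
noncomputable def defect (lam L K c D γ r : ℝ) : ℝ :=
  L ^ 2 * c ^ 2 / (4 * lam ^ 2) * (r ^ (2 - 2 * γ) / (2 - 2 * γ))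
    + K * c * D * (r ^ (1 - γ) / (1 - γ)) + K * D ^ 2 * r

lemma defect_zero (lam L K c D : ℝ) {γ : ℝ} (h1 : γ < 1) : defect lam L K c D γ 0 = 0 := by
  rw [defect, Real.zero_rpow (by linarith), Real.zero_rpow (by linarith)]
  simp

lemma continuous_defect (lam L K c D : ℝ) {γ : ℝ} (h1 : γ < 1) :
    Continuous (defect lam L K c D γ) := by
  unfold defect
  have c1 := Real.continuous_rpow_const (q := 2 - 2 * γ) (by linarith)
  have c2 := Real.continuous_rpow_const (q := 1 - γ) (by linarith)
  fun_prop

lemma hasDerivAt_defect (lam L K c D : ℝ) {γ : ℝ} (h1 : γ < 1) {r : ℝ} (hr : 0 < r) :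
    HasDerivAt (defect lam L K c D γ)
      (L ^ 2 * c ^ 2 / (4 * lam ^ 2) * r ^ (1 - 2 * γ) + K * c * D * r ^ (-γ) + K * D ^ 2) r := by
  have d1 : HasDerivAt (fun r : ℝ => r ^ (2 - 2 * γ) / (2 - 2 * γ)) (r ^ (1 - 2 * γ)) r := by
    refine ((Real.hasDerivAt_rpow_const (Or.inl hr.ne')).div_const _).congr_deriv ?_
    rw [mul_div_cancel_left₀ _ (by linarith)]
    congr 1
    ring
  have d2 : HasDerivAt (fun r : ℝ => r ^ (1 - γ) / (1 - γ)) (r ^ (-γ)) r := by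
    refine ((Real.hasDerivAt_rpow_const (Or.inl hr.ne')).div_const _).congr_deriv ?_
    rw [mul_div_cancel_left₀ _ (by linarith)]
    congr 1
    ring
  have d3 : HasDerivAt (fun r : ℝ => K * D ^ 2 * r) (K * D ^ 2) r := by
    simpa using (hasDerivAt_id r).const_mul (K * D ^ 2)
  exact ((d1.const_mul _).add (d2.const_mul _)).add d3

lemma defect_mono {lam L K c D γ r s : ℝ} (hK : 0 ≤ K) (hc : 0 ≤ c) (hD : 0 ≤ D) (h1 : γ < 1)
    (hr : 0 ≤ r) (hrs : r ≤ s) : defect lam L K c D γ r ≤ defect lam L K c D γ s := by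
  have e1 : 0 ≤ 2 - 2 * γ := by linarith
  have e2 : 0 ≤ 1 - γ := by linarith
  unfold defect
  gcongr

/-- One time step of the comparison between the frozen semigroup `e^{rA₀}` and the propagator of
`A + J`. With `w(r) = e^{rA₀}y` and the backward solution `v(r) = e^{(a+dt-r)(A+J)*}z`, the
derivative of `⟨w, v⟩` contains `a₀(w, v) - a(w, v)`, of size `L r p(w) p(v)`. The energy
`lam p(v)²` which the derivative of `‖v‖²/2` supplies absorbs the factor `p(v)`, so that no
pointwise bound of `p(v)` is needed and every `γ < 1` is admissible. -/
lemma inner_add_defect_step_le {A₀ A J : X →L[ℝ] X} (h₀ : IsSectorial p lam C A₀)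
    (h : IsSectorial p lam C A) {L K a dt γ c D : ℝ} (hL : 0 ≤ L) (hJ : ‖J‖ ≤ K)
    (ha : 0 ≤ a) (hdt : 0 ≤ dt) (h1 : γ < 1) (hc : 0 ≤ c)
    (hlip : ∀ u v, |inner ℝ ((A₀ - A) u) v| ≤ L * a * (p u * p v)) {y z : X}
    (hy : HasSmoothing A₀ γ c y)
    (hz : ∀ s ∈ Set.Icc 0 dt, ‖opExp (s • ContinuousLinearMap.adjoint (A + J)) z‖ ≤ D) :
    inner ℝ (opExp (a • A₀) y) (opExp (dt • ContinuousLinearMap.adjoint (A + J)) z)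
        + ‖opExp (dt • ContinuousLinearMap.adjoint (A + J)) z‖ ^ 2 / 2
        + defect lam L K c D γ a
      ≤ inner ℝ (opExp ((a + dt) • A₀) y) z + ‖z‖ ^ 2 / 2 + defect lam L K c D γ (a + dt) := by
  set B := ContinuousLinearMap.adjoint (A + J) with hB
  have hl := h.lam_pos
  have hK : 0 ≤ K := (norm_nonneg J).trans hJ
  let w : ℝ → X := fun r => opExp (r • A₀) y
  let v : ℝ → X := fun r => opExp ((a + dt - r) • B) z
  have hw : ∀ r, HasDerivAt w (A₀ (w r)) r := hasDerivAt_opExp_apply A₀ y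
  have hv : ∀ r, HasDerivAt v (-B (v r)) r := fun r =>
    HasDerivAt.comp_const_sub (a + dt) r (hasDerivAt_opExp_apply B z (a + dt - r))
  have hwv : ∀ r, HasDerivAt (fun r => inner ℝ (w r) (v r) + ‖v r‖ ^ 2 / 2)
      (inner ℝ (w r) (-B (v r)) + inner ℝ (A₀ (w r)) (v r)
        + 2 * inner ℝ (v r) (-B (v r)) / 2) r := fun r =>
    ((hw r).inner ℝ (hv r)).add ((hv r).norm_sq.div_const 2)
  have hmono : MonotoneOn
      (fun r => inner ℝ (w r) (v r) + ‖v r‖ ^ 2 / 2 + defect lam L K c D γ r)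
      (Set.Icc a (a + dt)) := by
    refine monotoneOn_of_hasDerivWithinAt_nonneg (convex_Icc _ _) ?_ (f' := fun r =>
      (inner ℝ (w r) (-B (v r)) + inner ℝ (A₀ (w r)) (v r) + 2 * inner ℝ (v r) (-B (v r)) / 2)
        + (L ^ 2 * c ^ 2 / (4 * lam ^ 2) * r ^ (1 - 2 * γ) + K * c * D * r ^ (-γ) + K * D ^ 2))
      ?_ ?_
    · exact ((continuous_iff_continuousAt.2 fun r => (hwv r).continuousAt).add
        (continuous_defect lam L K c D h1)).continuousOn
    · intro r hr
      rw [interior_Icc] at hr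
      exact ((hwv r).add
        (hasDerivAt_defect lam L K c D h1 (ha.trans_lt hr.1))).hasDerivWithinAt
    · intro r hr
      rw [interior_Icc] at hr
      have hr0 : 0 < r := ha.trans_lt hr.1
      have e1 : inner ℝ (w r) (B (v r)) = inner ℝ (A (w r)) (v r) + inner ℝ (J (w r)) (v r) := by
        rw [hB, ContinuousLinearMap.adjoint_inner_right, add_apply, inner_add_left]
      have e2 : inner ℝ (v r) (B (v r)) = inner ℝ (A (v r)) (v r) + inner ℝ (J (v r)) (v r) := by
        rw [hB, ContinuousLinearMap.adjoint_inner_right, add_apply, inner_add_left]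
      have hvD : ‖v r‖ ≤ D := hz _ ⟨by linarith [hr.2], by linarith [hr.1]⟩
      have hD : 0 ≤ D := (norm_nonneg _).trans hvD
      have hJb : ∀ x : X, inner ℝ (J x) (v r) ≤ K * ‖x‖ * D := fun x =>
        (real_inner_le_norm _ _).trans (by
          have := J.le_of_opNorm_le hJ x
          gcongr)
      have b1 : inner ℝ (J (w r)) (v r) ≤ K * c * D * r ^ (-γ) :=
        (hJb _).trans ((mul_le_mul_of_nonneg_right
          (mul_le_mul_of_nonneg_left (hy r hr0).1 hK) hD).trans_eq (by ring))
      have b2 : inner ℝ (J (v r)) (v r) ≤ K * D ^ 2 :=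
        (hJb _).trans ((mul_le_mul_of_nonneg_right
          (mul_le_mul_of_nonneg_left hvD hK) hD).trans_eq (by ring))
      have b3 := h.coercive (v r)
      have b4 : inner ℝ (A (w r)) (v r) - inner ℝ (A₀ (w r)) (v r)
          ≤ L * r * (p (w r) * p (v r)) := by
        rw [← inner_sub_left]
        have := hlip (w r) (v r)
        rw [sub_apply, ← abs_neg, ← inner_neg_left, neg_sub] at this
        have n1 := h.energy_nonneg (w r)
        have n2 := h.energy_nonneg (v r)
        refine ((le_abs_self _).trans this).trans ?_
        gcongr
        exact hr.1.le
      -- Young's inequality, weighted so that the factor `p (v r)` costs exactly the dissipation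
      have b5 : L * r * (p (w r) * p (v r))
          ≤ lam * p (v r) ^ 2 + L ^ 2 / (4 * lam ^ 2) * (r ^ 2 * (lam * p (w r) ^ 2)) := by
        have : 0 ≤ lam * (p (v r) - L * r * p (w r) / (2 * lam)) ^ 2 := by positivity
        have e : lam * (p (v r) - L * r * p (w r) / (2 * lam)) ^ 2 = lam * p (v r) ^ 2
            + L ^ 2 / (4 * lam ^ 2) * (r ^ 2 * (lam * p (w r) ^ 2))
            - L * r * (p (w r) * p (v r)) := by
          field_simp
          ring
        linarith
      have b6 : L ^ 2 / (4 * lam ^ 2) * (r ^ 2 * (lam * p (w r) ^ 2))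
          ≤ L ^ 2 * c ^ 2 / (4 * lam ^ 2) * r ^ (1 - 2 * γ) := by
        have e : r ^ (1 - 2 * γ) = r ^ 2 * (r ^ (-γ) * r ^ (-γ - 1)) := by
          rw [← Real.rpow_natCast, ← Real.rpow_add hr0, ← Real.rpow_add hr0]
          congr 1
          push_cast
          ring
        calc _ ≤ L ^ 2 / (4 * lam ^ 2) * (r ^ 2 * (c ^ 2 * r ^ (-γ) * r ^ (-γ - 1))) := by
              exact mul_le_mul_of_nonneg_left
                (mul_le_mul_of_nonneg_left (hy.energy_sq_le h₀ hc hr0) (by positivity))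
                (by positivity)
          _ = _ := by rw [e]; ring
      change (0 : ℝ) ≤ _
      rw [inner_neg_right, inner_neg_right, e1, e2]
      linarith
  have hend := hmono (Set.left_mem_Icc.2 (by linarith)) (Set.right_mem_Icc.2 (by linarith))
    (by linarith : a ≤ a + dt)
  simp only [w, v, add_sub_cancel_left, sub_self, zero_smul, opExp_zero, one_apply_eq_self] at hend
  exact hend

lemma adjoint_opExp (B : X →L[ℝ] X) (t : ℝ) :
    ContinuousLinearMap.adjoint (opExp (t • B))
      = opExp (t • ContinuousLinearMap.adjoint B) := by
  let _ : NormedAlgebra ℚ (X →L[ℝ] X) := NormedAlgebra.restrictScalars ℚ ℝ _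
  rw [← ContinuousLinearMap.star_eq_adjoint, ← ContinuousLinearMap.star_eq_adjoint, opExp, opExp,
    NormedSpace.star_exp, star_smul, star_trivial]

lemma norm_opExp_adjoint_apply_le {A J : X →L[ℝ] X} (h : IsSectorial p lam C A) {K : ℝ}
    (hJ : ‖J‖ ≤ K) {t : ℝ} (ht : 0 ≤ t) (x : X) :
    ‖opExp (t • ContinuousLinearMap.adjoint (A + J)) x‖ ≤ Real.exp (K * t) * ‖x‖ := by
  refine norm_opExp_apply_le (fun v => ?_) ht x
  rw [ContinuousLinearMap.adjoint_inner_left, real_inner_comm, add_apply, inner_add_left]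
  have h1 := h.inner_self_le v
  have h2 : 0 ≤ lam * ‖v‖ ^ 2 := by
    have := h.lam_pos
    positivity
  have h3 : inner ℝ (J v) v ≤ K * ‖v‖ * ‖v‖ := (real_inner_le_norm _ _).trans (by
    have := J.le_of_opNorm_le hJ v
    gcongr)
  nlinarith

/-- The constant in the smoothing estimate for products of exponentials. -/
noncomputable def productConst (lam C L K T γ : ℝ) : ℝ :=
  smoothingConst lam C γ
    + (1 / 2 + defect lam L K (smoothingConst lam C γ) (Real.exp (K * T)) γ T) * T ^ γ

/-- The smoothing estimate for a product of exponentials of bounded perturbations `A_j + J_j` of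
sectorial operators `A_j` whose forms depend on time in a Lipschitz continuous way. The constant
depends only on the listed parameters. The `J_j` need no regularity in `j`. -/
theorem norm_orderedProd_mul_negPow_le {L K T dt γ : ℝ} (hC : 0 ≤ C) (hL : 0 ≤ L) (hK : 0 ≤ K)
    (hdt : 0 < dt)
    (h0 : 0 ≤ γ) (h1 : γ < 1) {M k m : ℕ} (hkm : k ≤ m) (hm : m < M) (hM : M * dt ≤ T)
    {A J : ℕ → X →L[ℝ] X} (hA : ∀ j < M, IsSectorial p lam C (A j)) (hJ : ∀ j < M, ‖J j‖ ≤ K)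
    (hlip : ∀ i j, i ≤ j → j < M → ∀ u v,
      |inner ℝ ((A i - A j) u) v| ≤ L * ((j - i : ℕ) * dt) * (p u * p v)) :
    ‖orderedProd (fun j => opExp (dt • (A j + J j))) k m * negPow (A k) γ‖
      ≤ productConst lam C L K T γ * ((m - k + 1 : ℕ) * dt) ^ (-γ) := by
  have hAk := hA k (hkm.trans_lt hm)
  have hl := hAk.lam_pos
  unfold productConst
  set c := smoothingConst lam C γ with hcdef
  set D := Real.exp (K * T) with hD
  set H : ℕ → X →L[ℝ] X := fun j => opExp (dt • (A j + J j)) with hH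
  have hc : 0 ≤ c := smoothingConst_nonneg hl hC h0 h1
  set a : ℝ := (m - k + 1 : ℕ) * dt with ha
  have ha0 : 0 < a := by positivity
  have haT : a ≤ T := by
    refine le_trans ?_ hM
    rw [ha]
    gcongr
    omega
  have hT : 0 < T := ha0.trans_le haT
  have hdef : 0 ≤ defect lam L K c D γ T := by
    rw [← defect_zero lam L K c D h1]
    exact defect_mono hK hc (Real.exp_pos _).le h1 le_rfl hT.le
  have hTa : 1 ≤ T ^ γ * a ^ (-γ) := by
    rw [Real.rpow_neg ha0.le, ← div_eq_mul_inv, one_le_div (by positivity)]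
    exact Real.rpow_le_rpow ha0.le haT h0
  -- the estimate of the bilinear form of the product on the unit ball
  have key : ∀ x z : X, ‖x‖ ≤ 1 → ‖z‖ ≤ 1 →
      inner ℝ (orderedProd H k m (negPow (A k) γ x)) z
        ≤ c * a ^ (-γ) + (1 / 2 + defect lam L K c D γ T) := by
    intro x z hx hz
    set y := negPow (A k) γ x with hy
    have hys : HasSmoothing (A k) γ c y := by
      intro r hr
      obtain ⟨s1, s2⟩ := hAk.hasSmoothing_negPow h0 h1 x r hr
      have : c * ‖x‖ ≤ c := mul_le_of_le_one_right hc hx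
      exact ⟨s1.trans (by gcongr), s2.trans (by gcongr)⟩
    -- the backward solution at the grid points
    let Z : ℕ → X := fun j => ContinuousLinearMap.adjoint (orderedProd H j m) z
    have hZend : Z (m + 1) = z := by
      simp only [Z, orderedProd_succ_self]
      rw [← ContinuousLinearMap.star_eq_adjoint, star_one, one_apply_eq_self]
    have hZ : ∀ j ≤ m, Z j
        = opExp (dt • ContinuousLinearMap.adjoint (A j + J j)) (Z (j + 1)) := by
      intro j hj
      simp only [Z]
      rw [orderedProd_eq_mul H hj, ← adjoint_opExp, ← ContinuousLinearMap.star_eq_adjoint,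
        star_mul]
      rfl
    have hZn : ∀ n j, j + n = m + 1 → ‖Z j‖ ≤ Real.exp (K * (n * dt)) := by
      intro n
      induction n with
      | zero =>
        intro j hj
        rw [add_zero] at hj
        rw [hj, hZend]
        simpa using hz
      | succ n ih =>
        intro j hj
        rw [hZ j (by omega)]
        have e : Real.exp (K * ((n + 1 : ℕ) * dt))
            = Real.exp (K * dt) * Real.exp (K * (n * dt)) := by
          rw [← Real.exp_add]
          congr 1
          push_cast
          ring
        rw [e]
        refine (norm_opExp_adjoint_apply_le (hA j (by omega)) (hJ j (by omega)) hdt.le _).trans ?_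
        gcongr
        exact ih (j + 1) (by omega)
    -- the monotone quantity of `inner_add_defect_step_le` at the grid points
    let G : ℕ → ℝ := fun n => inner ℝ (opExp ((n * dt) • A k) y) (Z (k + n))
      + ‖Z (k + n)‖ ^ 2 / 2 + defect lam L K c D γ (n * dt)
    have hG : ∀ n, k + n ≤ m → G n ≤ G (n + 1) := by
      intro n hn
      have hstep := inner_add_defect_step_le (D := D) hAk (hA (k + n) (by omega)) hL
        (hJ (k + n) (by omega)) (a := n * dt) (dt := dt) (by positivity) hdt.le h1 hc
        (by simpa using hlip k (k + n) (by omega) (by omega)) hys (z := Z (k + n + 1)) (by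
          intro s hs
          refine (norm_opExp_adjoint_apply_le (hA _ (by omega)) (hJ _ (by omega)) hs.1 _).trans ?_
          refine (mul_le_mul_of_nonneg_left (hZn (m - (k + n)) _ (by omega))
            (Real.exp_pos _).le).trans ?_
          rw [← Real.exp_add, hD, Real.exp_le_exp, ← mul_add]
          refine mul_le_mul_of_nonneg_left (le_trans ?_ hM) hK
          calc s + ((m - (k + n) : ℕ) : ℝ) * dt ≤ dt + ((m - (k + n) : ℕ) : ℝ) * dt := by
                gcongr
                exact hs.2
            _ = ((m - (k + n) + 1 : ℕ) : ℝ) * dt := by push_cast; ring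
            _ ≤ M * dt := by
                gcongr
                omega)
      rw [← hZ (k + n) hn] at hstep
      simp only [G]
      rw [show k + (n + 1) = k + n + 1 by ring,
        show ((n + 1 : ℕ) : ℝ) * dt = n * dt + dt by push_cast; ring]
      exact hstep
    have hGle : ∀ n, k + n ≤ m + 1 → G 0 ≤ G n := by
      intro n
      induction n with
      | zero => exact fun _ => le_rfl
      | succ n ih => exact fun hn => (ih (by omega)).trans (hG n (by omega))
    have hfin := hGle (m - k + 1) (by omega)
    simp only [G] at hfin
    rw [show k + (m - k + 1) = m + 1 by omega, hZend, ← ha, Nat.cast_zero, zero_mul, zero_smul,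
      opExp_zero, one_apply_eq_self, add_zero, defect_zero _ _ _ _ _ h1, add_zero] at hfin
    have e1 : inner ℝ (orderedProd H k m y) z = inner ℝ y (Z k) :=
      (ContinuousLinearMap.adjoint_inner_right _ _ _).symm
    have e2 : inner ℝ (opExp (a • A k) y) z ≤ c * a ^ (-γ) :=
      (real_inner_le_norm _ _).trans
        ((mul_le_mul (hys a ha0).1 hz (norm_nonneg _) (by positivity)).trans_eq (mul_one _))
    have e3 : defect lam L K c D γ a ≤ defect lam L K c D γ T :=
      defect_mono hK hc (Real.exp_pos _).le h1 ha0.le haT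
    have e4 : ‖z‖ ^ 2 ≤ 1 := pow_le_one₀ (norm_nonneg _) hz
    have e5 : 0 ≤ ‖Z k‖ ^ 2 := by positivity
    rw [e1]
    linarith
  have hR : c * a ^ (-γ) + (1 / 2 + defect lam L K c D γ T)
      ≤ (c + (1 / 2 + defect lam L K c D γ T) * T ^ γ) * a ^ (-γ) := by
    have : (1 / 2 + defect lam L K c D γ T) * 1
        ≤ (1 / 2 + defect lam L K c D γ T) * (T ^ γ * a ^ (-γ)) := by
      gcongr
    linarith
  refine ContinuousLinearMap.opNorm_le_of_unit_norm (by positivity) fun x hx => le_trans ?_ hR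
  set q := (orderedProd H k m * negPow (A k) γ) x with hq
  have hk := key x (‖q‖⁻¹ • q) hx.le (by
    rw [norm_smul, norm_inv, norm_norm]
    exact inv_mul_le_one)
  rw [show orderedProd H k m (negPow (A k) γ x) = q from rfl, inner_smul_right,
    real_inner_self_eq_norm_sq] at hk
  refine le_of_eq_of_le ?_ hk
  rcases eq_or_ne ‖q‖ 0 with h | h
  · rw [h]
    simp
  · field_simp

end OrderedProduct

/-! ### The energy space as a space of pairs `(u, ∇u)` -/

section GraphSpace

variable {d : ℕ} {Λ : Set (Space d)}

lemma IsTestFunction.memLp {φ : Space d → ℝ} (h : IsTestFunction Λ φ) :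
    MemLp φ 2 (volume.restrict Λ) :=
  (h.1.continuous.memLp_of_hasCompactSupport h.2.1).restrict Λ

lemma IsTestFunction.memLp_pderiv {φ : Space d → ℝ} (h : IsTestFunction Λ φ) (i : Fin d) :
    MemLp (pderiv i φ) 2 (volume.restrict Λ) :=
  ((h.continuous_pderiv i).memLp_of_hasCompactSupport
    (h.2.1.fderiv_apply (𝕜 := ℝ) _)).restrict Λ

lemma continuous_integral_mul {χ : Space d → ℝ} (hχ : MemLp χ 2 (volume.restrict Λ)) :
    Continuous (fun u : L2 Λ => ∫ x in Λ, u x * χ x) := by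
  have e : (fun u : L2 Λ => ∫ x in Λ, u x * χ x) = fun u => inner ℝ u hχ.toLp := by
    funext u
    rw [L2.inner_def]
    refine integral_congr_ae ?_
    filter_upwards [hχ.coeFn_toLp] with x hx
    simp [hx, mul_comm]
  rw [e]
  fun_prop

/-- The weak derivative is a closed operator. -/
lemma isClosed_hasWeakPartial (i : Fin d) :
    IsClosed {w : L2 Λ × L2 Λ | HasWeakPartial i w.1 w.2} := by
  simp only [HasWeakPartial, Set.ofPred_forall]
  refine isClosed_iInter fun φ => isClosed_iInter fun hφ => isClosed_eq ?_ ?_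
  · exact (continuous_integral_mul (hφ.memLp_pderiv i)).comp continuous_fst
  · exact ((continuous_integral_mul hφ.memLp).comp continuous_snd).neg

/-- Integration by parts for test functions. -/
lemma IsTestFunction.hasWeakPartial {φ : Space d → ℝ} (h : IsTestFunction Λ φ) {u g : L2 Λ}
    {i : Fin d} (hu : u =ᵐ[volume.restrict Λ] φ) (hg : g =ᵐ[volume.restrict Λ] pderiv i φ) :
    HasWeakPartial i u g := by
  intro ψ hψ
  have e1 : ∫ x in Λ, u x * pderiv i ψ x = ∫ x in Λ, φ x * pderiv i ψ x := by
    refine integral_congr_ae ?_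
    filter_upwards [hu] with x hx
    rw [hx]
  have e2 : ∫ x in Λ, g x * ψ x = ∫ x in Λ, pderiv i φ x * ψ x := by
    refine integral_congr_ae ?_
    filter_upwards [hg] with x hx
    rw [hx]
  have z : ∀ {η : Space d → ℝ}, IsTestFunction Λ η → ∀ x ∉ Λ, η x = 0 := fun hη x hx => by
    by_contra hne
    exact hx (hη.2.2 (subset_tsupport _ hne))
  rw [e1, e2,
    setIntegral_eq_integral_of_forall_compl_eq_zero fun x hx => by rw [z h x hx, zero_mul],
    setIntegral_eq_integral_of_forall_compl_eq_zero fun x hx => by rw [z hψ x hx, mul_zero]]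
  exact integral_mul_fderiv_eq_neg_fderiv_mul_of_integrable (μ := volume) (𝕜 := ℝ)
    (((h.continuous_pderiv i).mul hψ.1.continuous).integrable_of_hasCompactSupport
      hψ.2.1.mul_left)
    ((h.1.continuous.mul (hψ.continuous_pderiv i)).integrable_of_hasCompactSupport
      h.2.1.mul_right)
    ((h.1.continuous.mul hψ.1.continuous).integrable_of_hasCompactSupport hψ.2.1.mul_left)
    (fun x _ => h.1.differentiable (by simp) x) (fun x _ => hψ.1.differentiable (by simp) x)

/-- The ambient space of pairs `(u, ∇u)`. -/
abbrev GraphPair (Λ : Set (Space d)) : Type := L2 Λ × (Fin d → L2 Λ)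

/-- `H¹(Λ)` as the space of pairs `(u, ∇u)`. -/
def graphH1 (Λ : Set (Space d)) : Submodule ℝ (GraphPair Λ) where
  carrier := {w | ∀ i, HasWeakPartial i w.1 (w.2 i)}
  zero_mem' := fun i => HasWeakPartial.zero i
  add_mem' := fun hu hv i => (hu i).add (hv i)
  smul_mem' := fun c _ hu i => (hu i).smul c

lemma isClosed_graphH1 : IsClosed (graphH1 Λ : Set (GraphPair Λ)) := by
  have : (graphH1 Λ : Set (GraphPair Λ))
      = ⋂ i, (fun w : GraphPair Λ => (w.1, w.2 i)) ⁻¹' {w | HasWeakPartial i w.1 w.2} := by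
    ext w
    simp [graphH1]
  rw [this]
  exact isClosed_iInter fun i => (isClosed_hasWeakPartial i).preimage (by fun_prop)

/-- The pairs `(φ, ∇φ)` for test functions `φ`. -/
def graphTest (Λ : Set (Space d)) : Submodule ℝ (GraphPair Λ) where
  carrier := {w | ∃ φ, IsTestFunction Λ φ ∧ w.1 =ᵐ[volume.restrict Λ] φ ∧
    ∀ i, w.2 i =ᵐ[volume.restrict Λ] pderiv i φ}
  zero_mem' := by
    refine ⟨fun _ => 0, IsTestFunction.zero, Lp.coeFn_zero _ _ _, fun i => ?_⟩
    have : pderiv i (fun _ : Space d => (0 : ℝ)) = 0 := by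
      funext x
      simp [pderiv]
    rw [this]
    exact Lp.coeFn_zero _ _ _
  add_mem' := by
    rintro u v ⟨φ, h1, h2, h3⟩ ⟨ψ, k1, k2, k3⟩
    refine ⟨fun x => φ x + ψ x, h1.add k1, (Lp.coeFn_add _ _).trans (h2.add k2), fun i => ?_⟩
    have : pderiv i (fun x => φ x + ψ x) = pderiv i φ + pderiv i ψ := by
      funext x
      simp [pderiv, fderiv_fun_add (h1.1.differentiable (by simp) x)
        (k1.1.differentiable (by simp) x)]
    rw [this]
    exact (Lp.coeFn_add _ _).trans ((h3 i).add (k3 i))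
  smul_mem' := by
    rintro c u ⟨φ, h1, h2, h3⟩
    refine ⟨fun x => c * φ x, h1.smul c, (Lp.coeFn_smul _ _).trans (h2.const_smul c), fun i => ?_⟩
    have : pderiv i (fun x => c * φ x) = c • pderiv i φ := by
      funext x
      simp [pderiv, fderiv_const_mul (h1.1.differentiable (by simp) x)]
    rw [this]
    exact (Lp.coeFn_smul _ _).trans ((h3 i).const_smul c)

lemma graphTest_closure_le : (graphTest Λ).topologicalClosure ≤ graphH1 Λ :=
  Submodule.topologicalClosure_minimal _
    (fun _ ⟨_, h1, h2, h3⟩ i => h1.hasWeakPartial h2 (h3 i)) isClosed_graphH1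

lemma memH10_of_mem_closure {w : GraphPair Λ} (hw : w ∈ (graphTest Λ).topologicalClosure) :
    MemH10 w.1 := by
  obtain ⟨s, hs, hlim⟩ := mem_closure_iff_seq_limit.1 hw
  choose φ h1 h2 h3 using hs
  refine ⟨w.2, φ, h1, ?_, fun i => ?_⟩
  · have := (Lp.tendsto_Lp_iff_tendsto_eLpNorm' _ _).1 ((continuous_fst.tendsto w).comp hlim)
    refine this.congr fun n => eLpNorm_congr_ae ?_
    filter_upwards [h2 n] with x hx
    simp [hx]
  · have := (Lp.tendsto_Lp_iff_tendsto_eLpNorm' _ _).1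
      ((((continuous_apply i).comp continuous_snd).tendsto w).comp hlim)
    refine this.congr fun n => eLpNorm_congr_ae ?_
    filter_upwards [h3 n i] with x hx
    simp [hx]

lemma MemH10.exists_mem_closure {u : L2 Λ} (hu : MemH10 u) :
    ∃ g, (u, g) ∈ (graphTest Λ).topologicalClosure := by
  obtain ⟨g, φ, h1, h2, h3⟩ := hu
  refine ⟨g, mem_closure_iff_seq_limit.2 ⟨fun n =>
    ((h1 n).memLp.toLp, fun i => ((h1 n).memLp_pderiv i).toLp), fun n =>
      ⟨φ n, h1 n, (h1 n).memLp.coeFn_toLp, fun i => ((h1 n).memLp_pderiv i).coeFn_toLp⟩, ?_⟩⟩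
  refine Tendsto.prodMk_nhds ?_ (tendsto_pi_nhds.2 fun i => ?_)
  · rw [Lp.tendsto_Lp_iff_tendsto_eLpNorm']
    refine h2.congr fun n => eLpNorm_congr_ae ?_
    filter_upwards [(h1 n).memLp.coeFn_toLp] with x hx
    simp [hx]
  · rw [Lp.tendsto_Lp_iff_tendsto_eLpNorm']
    refine (h3 i).congr fun n => eLpNorm_congr_ae ?_
    filter_upwards [((h1 n).memLp_pderiv i).coeFn_toLp] with x hx
    simp [hx]

/-- The energy space `V` as a space of pairs `(u, ∇u)`. -/
noncomputable def graphV (Λ : Set (Space d)) : BoundaryCondition → Submodule ℝ (GraphPair Λ)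
  | .dirichlet => (graphTest Λ).topologicalClosure
  | .robin _ => graphH1 Λ

lemma isClosed_graphV (bc : BoundaryCondition) : IsClosed (graphV Λ bc : Set (GraphPair Λ)) := by
  cases bc with
  | dirichlet => exact Submodule.isClosed_topologicalClosure _
  | robin _ => exact isClosed_graphH1

lemma memV_of_mem_graphV {bc : BoundaryCondition} {w : GraphPair Λ} (hw : w ∈ graphV Λ bc) :
    MemV bc w.1 := by
  cases bc with
  | dirichlet => exact memH10_of_mem_closure hw
  | robin _ => exact fun i => ⟨_, hw i⟩

lemma weakPartial_of_mem_graphV (hΛ : IsOpen Λ) {bc : BoundaryCondition} {w : GraphPair Λ}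
    (hw : w ∈ graphV Λ bc) : w.2 = fun i => weakPartial i w.1 := by
  have h : w ∈ graphH1 Λ := by
    cases bc with
    | dirichlet => exact graphTest_closure_le hw
    | robin _ => exact hw
  funext i
  exact (weakPartial_eq hΛ (h i)).symm

/-- The pair `(u, ∇u)`. -/
noncomputable def withGradient (u : L2 Λ) : GraphPair Λ := (u, fun i => weakPartial i u)

lemma MemV.withGradient_mem (hΛ : IsOpen Λ) {bc : BoundaryCondition} {u : L2 Λ}
    (hu : MemV bc u) : withGradient u ∈ graphV Λ bc := by
  cases bc with
  | dirichlet =>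
    obtain ⟨g, hg⟩ := MemH10.exists_mem_closure hu
    have := weakPartial_of_mem_graphV hΛ (bc := .dirichlet) hg
    simp only at this
    rw [this] at hg
    exact hg
  | robin _ =>
    intro i
    obtain ⟨g, hg⟩ := hu i
    have := weakPartial_eq hΛ hg
    change HasWeakPartial i u (weakPartial i u)
    rwa [this]

lemma normH1Sq_nonneg (u : L2 Λ) : 0 ≤ normH1Sq u := by
  unfold normH1Sq
  positivity

lemma norm_withGradient_le (u : L2 Λ) : ‖withGradient u‖ ≤ √(normH1Sq u) := by
  refine norm_prod_le_iff.2 ⟨Real.le_sqrt_of_sq_le ?_,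
    (pi_norm_le_iff_of_nonneg (Real.sqrt_nonneg _)).2 fun i => Real.le_sqrt_of_sq_le ?_⟩
  · exact le_add_of_nonneg_right (Finset.sum_nonneg fun _ _ => by positivity)
  · exact (Finset.single_le_sum (f := fun i : Fin d => ‖weakPartial i u‖ ^ 2)
      (fun _ _ => by positivity) (Finset.mem_univ i)).trans
      (le_add_of_nonneg_left (by positivity))

end GraphSpace

/-! ### Uniform bounds for the forms `a_Λ(t)` -/

section VolumeForm

variable {d : ℕ} {Λ : Set (Space d)}

lemma integrable_weight_mul (hΛ : IsOpen Λ) {κ : Space d → ℝ} (hκ : ContinuousOn κ (closure Λ))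
    {R : ℝ} (hR : ∀ x ∈ closure Λ, |κ x| ≤ R) (u v : L2 Λ) :
    Integrable (fun x => κ x * (u x * v x)) (volume.restrict Λ) := by
  refine Integrable.bdd_mul (c := R)
    (MemLp.integrable_mul (p := 2) (q := 2) (Lp.memLp u) (Lp.memLp v))
    ((hκ.mono subset_closure).aestronglyMeasurable hΛ.measurableSet) ?_
  filter_upwards [ae_restrict_mem hΛ.measurableSet] with x hx
  exact hR x (subset_closure hx)

/-- A bounded weight `κ` makes `∫ κ u v` a bounded bilinear form on `L²(Λ)`. -/
lemma exists_weightForm (hΛ : IsOpen Λ) {κ : Space d → ℝ} (hκ : ContinuousOn κ (closure Λ))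
    {R : ℝ} (hR : ∀ x ∈ closure Λ, |κ x| ≤ R) :
    ∃ b : L2 Λ →L[ℝ] L2 Λ →L[ℝ] ℝ, (∀ u v, b u v = ∫ x in Λ, κ x * (u x * v x)) ∧
      ∀ u v, |b u v| ≤ R * ‖u‖ * ‖v‖ := by
  have hint := integrable_weight_mul hΛ hκ hR
  have hcomm : ∀ u v : L2 Λ,
      ∫ x in Λ, κ x * (u x * v x) = ∫ x in Λ, κ x * (v x * u x) := by
    intro u v
    simp only [mul_comm (u _)]
  have hadd : ∀ u u' v : L2 Λ, ∫ x in Λ, κ x * ((u + u' : L2 Λ) x * v x)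
      = (∫ x in Λ, κ x * (u x * v x)) + ∫ x in Λ, κ x * (u' x * v x) := by
    intro u u' v
    rw [← integral_add (hint u v) (hint u' v)]
    refine integral_congr_ae ?_
    filter_upwards [Lp.coeFn_add u u'] with x hx
    rw [hx, Pi.add_apply]
    ring
  have hsmul : ∀ (c : ℝ) (u v : L2 Λ), ∫ x in Λ, κ x * ((c • u : L2 Λ) x * v x)
      = c • ∫ x in Λ, κ x * (u x * v x) := by
    intro c u v
    rw [← integral_smul]
    refine integral_congr_ae ?_
    filter_upwards [Lp.coeFn_smul c u] with x hx
    rw [hx, Pi.smul_apply, smul_eq_mul, smul_eq_mul]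
    ring
  have hbound : ∀ u v : L2 Λ, |∫ x in Λ, κ x * (u x * v x)| ≤ R * ‖u‖ * ‖v‖ := by
    intro u v
    have hae : ∀ᵐ x ∂volume.restrict Λ, ‖κ x * u x‖ ≤ R * ‖u x‖ := by
      filter_upwards [ae_restrict_mem hΛ.measurableSet] with x hx
      rw [norm_mul]
      gcongr
      exact hR x (subset_closure hx)
    have hm : MemLp (fun x => κ x * u x) 2 (volume.restrict Λ) :=
      (Lp.memLp u).of_le_mul (((hκ.mono subset_closure).aestronglyMeasurable
        hΛ.measurableSet).mul (Lp.aestronglyMeasurable u)) hae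
    have e : ∫ x in Λ, κ x * (u x * v x) = inner ℝ hm.toLp v := by
      rw [L2.inner_def]
      refine integral_congr_ae ?_
      filter_upwards [hm.coeFn_toLp] with x hx
      simp only [hx, RCLike.inner_apply, conj_trivial]
      ring
    rw [e]
    refine (abs_real_inner_le_norm _ _).trans ?_
    gcongr
    refine Lp.norm_le_mul_norm_of_ae_le_mul ?_
    filter_upwards [hm.coeFn_toLp, hae] with x hx hx'
    rwa [hx]
  let β : L2 Λ →ₗ[ℝ] L2 Λ →ₗ[ℝ] ℝ := LinearMap.mk₂ ℝ
    (fun u v => ∫ x in Λ, κ x * (u x * v x)) hadd hsmul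
    (fun u v v' => by rw [hcomm, hadd, hcomm v, hcomm v'])
    (fun c u v => by rw [hcomm, hsmul, hcomm v])
  exact ⟨β.mkContinuous₂ R hbound, fun _ _ => rfl, hbound⟩

/-- A coefficient that is continuous in `x` and Hölder continuous in `t` is bounded. -/
lemma exists_coefficient_bound (hb : Bornology.IsBounded Λ) {T : ℝ} (hT : 0 ≤ T)
    {f : Space d → ℝ → ℝ} (hf : ContinuousOn (fun x => f x 0) (closure Λ))
    (hh : ∃ K η : ℝ, 0 < η ∧ ∀ x ∈ closure Λ, ∀ s ∈ Set.Icc 0 T, ∀ t ∈ Set.Icc 0 T,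
      |f x t - f x s| ≤ K * |t - s| ^ η) :
    ∃ R : ℝ, 0 ≤ R ∧ ∀ t ∈ Set.Icc 0 T, ∀ x ∈ closure Λ, |f x t| ≤ R := by
  obtain ⟨C, hC⟩ := hb.isCompact_closure.exists_bound_of_continuousOn hf
  obtain ⟨K, η, hη, hK⟩ := hh
  refine ⟨|C| + |K| * T ^ η, by positivity, fun t ht x hx => ?_⟩
  have h1 := hK x hx 0 ⟨le_rfl, hT⟩ t ht
  have h2 : K * |t - 0| ^ η ≤ |K| * T ^ η := by
    rw [sub_zero, abs_of_nonneg ht.1]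
    have := Real.rpow_le_rpow ht.1 ht.2 hη.le
    have := Real.rpow_nonneg ht.1 η
    calc K * t ^ η ≤ |K| * t ^ η := by gcongr; exact le_abs_self K
      _ ≤ _ := by gcongr
  have h3 : |f x 0| ≤ |C| := (hC x hx).trans (le_abs_self C)
  calc |f x t| = |f x 0 + (f x t - f x 0)| := by rw [add_sub_cancel]
    _ ≤ |f x 0| + |f x t - f x 0| := abs_add_le _ _
    _ ≤ _ := by linarith

/-- The forms `a_Λ(t)` are bounded bilinear forms of `(u, ∇u)` and `(v, ∇v)`, uniformly in `t`. -/
lemma exists_graphForm (hΛ : IsOpen Λ) (hb : Bornology.IsBounded Λ) {T : ℝ} (hT : 0 ≤ T)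
    {bc : BoundaryCondition} {co : Coefficients d} (hco : IsAdmissible Λ T bc co) :
    ∃ R : ℝ, 0 ≤ R ∧ ∀ t ∈ Set.Icc 0 T, ∃ b : GraphPair Λ →L[ℝ] GraphPair Λ →L[ℝ] ℝ,
      (∀ u v, b (withGradient u) (withGradient v) = volumeForm co t u v) ∧
      ∀ w z, |b w z| ≤ R * ‖w‖ * ‖z‖ := by
  have h0 : (0 : ℝ) ∈ Set.Icc 0 T := ⟨le_rfl, hT⟩
  choose Rq hRq0 hRq using fun i j =>
    exists_coefficient_bound hb hT (hco.smooth_q i j 0 h0).continuousOn (hco.holder_q i j)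
  choose Rb hRb0 hRb using fun i =>
    exists_coefficient_bound hb hT (hco.smooth_b i 0 h0).continuousOn (hco.holder_b i)
  refine ⟨(∑ i, ∑ j, Rq i j) + (∑ i, Rb i) + |co.c₀|,
    add_nonneg (add_nonneg (Finset.sum_nonneg fun i _ => Finset.sum_nonneg fun j _ => hRq0 i j)
      (Finset.sum_nonneg fun i _ => hRb0 i)) (abs_nonneg _), fun t ht => ?_⟩
  have cq := fun i j => (hco.smooth_q i j t ht).continuousOn
  have cb := fun i => (hco.smooth_b i t ht).continuousOn
  choose mq hmq hmq' using fun i j =>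
    exists_weightForm hΛ (cq i j) (hRq i j t ht)
  choose mb hmb hmb' using fun i => exists_weightForm hΛ (cb i) (hRb i t ht)
  obtain ⟨mc, hmc, hmc'⟩ := exists_weightForm hΛ (κ := fun _ => co.c₀) continuousOn_const
    (R := |co.c₀|) fun _ _ => le_rfl
  let π : Fin d → GraphPair Λ →L[ℝ] L2 Λ := fun i =>
    (ContinuousLinearMap.proj i).comp (ContinuousLinearMap.snd ℝ (L2 Λ) (Fin d → L2 Λ))
  let π₀ : GraphPair Λ →L[ℝ] L2 Λ := ContinuousLinearMap.fst ℝ (L2 Λ) (Fin d → L2 Λ)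
  let b : GraphPair Λ →L[ℝ] GraphPair Λ →L[ℝ] ℝ :=
    (∑ i, ∑ j, (mq i j).bilinearComp (π i) (π j)) + (∑ i, (mb i).bilinearComp (π i) π₀)
      + mc.bilinearComp π₀ π₀
  have hbapp : ∀ w z, b w z = (∑ i, ∑ j, mq i j (w.2 i) (z.2 j)) + (∑ i, mb i (w.2 i) z.1)
      + mc w.1 z.1 := by
    intro w z
    simp [b, π, π₀]
  refine ⟨b, fun u v => ?_, fun w z => ?_⟩
  · have iq := fun i j => integrable_weight_mul hΛ (cq i j) (hRq i j t ht)
      (weakPartial i u) (weakPartial j v)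
    have ib := fun i => integrable_weight_mul hΛ (cb i) (hRb i t ht) (weakPartial i u) v
    have ic := integrable_weight_mul hΛ (κ := fun _ => co.c₀) continuousOn_const
      (fun _ _ => le_rfl) u v
    rw [hbapp]
    simp only [withGradient, hmq, hmb, hmc, volumeForm, mul_assoc]
    rw [integral_add, integral_add, integral_finsetSum, integral_finsetSum]
    · congr 2
      refine Finset.sum_congr rfl fun i _ => ?_
      rw [integral_finsetSum _ fun j _ => iq i j]
    · exact fun i _ => ib i
    · exact fun i _ => integrable_finsetSum _ fun j _ => iq i j
    · exact integrable_finsetSum _ fun i _ => integrable_finsetSum _ fun j _ => iq i j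
    · exact integrable_finsetSum _ fun i _ => ib i
    · exact (integrable_finsetSum _ fun i _ => integrable_finsetSum _ fun j _ => iq i j).add
        (integrable_finsetSum _ fun i _ => ib i)
    · exact ic
  · have n2 : ∀ (w : GraphPair Λ) i, ‖w.2 i‖ ≤ ‖w‖ := fun w i =>
      (norm_le_pi_norm w.2 i).trans (norm_snd_le w)
    have n1 : ∀ w : GraphPair Λ, ‖w.1‖ ≤ ‖w‖ := norm_fst_le
    rw [hbapp, add_mul, add_mul, add_mul, add_mul, Finset.sum_mul, Finset.sum_mul, Finset.sum_mul,
      Finset.sum_mul]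
    refine (abs_add_le _ _).trans (add_le_add ((abs_add_le _ _).trans (add_le_add ?_ ?_)) ?_)
    · refine (Finset.abs_sum_le_sum_abs _ _).trans (Finset.sum_le_sum fun i _ => ?_)
      rw [Finset.sum_mul, Finset.sum_mul]
      refine (Finset.abs_sum_le_sum_abs _ _).trans (Finset.sum_le_sum fun j _ => ?_)
      refine (hmq' i j _ _).trans ?_
      have := hRq0 i j
      gcongr
      exacts [n2 w i, n2 z j]
    · refine (Finset.abs_sum_le_sum_abs _ _).trans (Finset.sum_le_sum fun i _ => ?_)
      refine (hmb' i _ _).trans ?_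
      have := hRb0 i
      gcongr
      exacts [n2 w i, n1 z]
    · refine (hmc' _ _).trans ?_
      gcongr
      exacts [n1 w, n1 z]

/-- The forms `a_Λ(t)` are bounded in the norm of `H¹(Λ)`, uniformly in `t`. -/
lemma exists_volumeForm_bound (hΛ : IsOpen Λ) (hb : Bornology.IsBounded Λ) {T : ℝ} (hT : 0 ≤ T)
    {bc : BoundaryCondition} {co : Coefficients d} (hco : IsAdmissible Λ T bc co) :
    ∃ R : ℝ, 0 ≤ R ∧ ∀ t ∈ Set.Icc 0 T, ∀ u v : L2 Λ,
      |volumeForm co t u v| ≤ R * (√(normH1Sq u) * √(normH1Sq v)) := by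
  obtain ⟨R, hR0, hR⟩ := exists_graphForm hΛ hb hT hco
  refine ⟨R, hR0, fun t ht u v => ?_⟩
  obtain ⟨b, hb1, hb2⟩ := hR t ht
  rw [← hb1, ← mul_assoc]
  refine (hb2 _ _).trans ?_
  gcongr <;> exact norm_withGradient_le _

/-- The uniform boundedness principle for bilinear forms on a Banach space `V`, here given as
restrictions of forms on a larger space `E`. -/
lemma exists_bound_of_pointwise_bound {V E ι : Type*} [NormedAddCommGroup V] [NormedSpace ℝ V]
    [CompleteSpace V] [NormedAddCommGroup E] [NormedSpace ℝ E] (e : V →L[ℝ] E)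
    {b : ι → E →L[ℝ] E →L[ℝ] ℝ} (h : ∀ w z, ∃ K, ∀ i, |b i (e w) (e z)| ≤ K) :
    ∃ L : ℝ, 0 ≤ L ∧ ∀ i w z, |b i (e w) (e z)| ≤ L * (‖w‖ * ‖z‖) := by
  let q : ι → V →L[ℝ] V →L[ℝ] ℝ := fun i => (b i).bilinearComp e e
  obtain ⟨L, hL⟩ : ∃ L, ∀ i, ‖q i‖ ≤ L := banach_steinhaus fun w =>
    banach_steinhaus (g := fun i => q i w) fun z => h w z
  refine ⟨|L|, abs_nonneg L, fun i w z => ?_⟩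
  have := ContinuousLinearMap.le_of_opNorm₂_le_of_le (q i) (x := w) (y := z)
    ((hL i).trans (le_abs_self L)) le_rfl le_rfl
  exact this.trans_eq (mul_assoc _ _ _)

/-- Weak Lipschitz continuity in time is Lipschitz continuity in the norm of bounded bilinear forms
on `V`, by the uniform boundedness principle for the difference quotients. -/
lemma exists_volumeForm_lipschitz (hΛ : IsOpen Λ) (hb : Bornology.IsBounded Λ) {T : ℝ}
    (hT : 0 ≤ T) {bc : BoundaryCondition} {co : Coefficients d} (hco : IsAdmissible Λ T bc co) :
    ∃ L : ℝ, 0 ≤ L ∧ ∀ s ∈ Set.Icc 0 T, ∀ t ∈ Set.Icc 0 T, ∀ u v : L2 Λ, MemV bc u → MemV bc v →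
      |volumeForm co t u v - volumeForm co s u v|
        ≤ L * |t - s| * (√(normH1Sq u) * √(normH1Sq v)) := by
  obtain ⟨R, hR0, hR⟩ := exists_graphForm hΛ hb hT hco
  choose b hb1 hb2 using fun t : Set.Icc 0 T => hR t.1 t.2
  let q : Set.Icc 0 T × Set.Icc 0 T → GraphPair Λ →L[ℝ] GraphPair Λ →L[ℝ] ℝ := fun st =>
    |st.2.1 - st.1.1|⁻¹ • (b st.2 - b st.1)
  have hq : ∀ st (u v : L2 Λ), |q st (withGradient u) (withGradient v)| = |st.2.1 - st.1.1|⁻¹ *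
      |volumeForm co st.2 u v - volumeForm co st.1 u v| := by
    intro st u v
    have e : q st (withGradient u) (withGradient v) = |st.2.1 - st.1.1|⁻¹ *
      (b st.2 (withGradient u) (withGradient v) - b st.1 (withGradient u) (withGradient v)) := rfl
    rw [e, hb1, hb1, abs_mul, abs_inv, abs_abs]
  have hw : ∀ w ∈ graphV Λ bc, w = withGradient w.1 := fun w hw =>
    Prod.ext rfl (weakPartial_of_mem_graphV hΛ hw)
  have hcomp : CompleteSpace (graphV Λ bc) := (isClosed_graphV bc).completeSpace_coe
  obtain ⟨L, hL0, hL⟩ := exists_bound_of_pointwise_bound (graphV Λ bc).subtypeL (b := q) (by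
    rintro ⟨w, hwV⟩ ⟨z, hzV⟩
    obtain ⟨K, hK⟩ := hco.lipschitz w.1 z.1 (memV_of_mem_graphV hwV) (memV_of_mem_graphV hzV)
    refine ⟨|K|, fun st => ?_⟩
    change |q st w z| ≤ |K|
    rw [hw w hwV, hw z hzV, hq]
    have h1 := hK st.1 st.1.2 st.2 st.2.2
    calc _ ≤ |st.2.1 - st.1.1|⁻¹ * (|K| * |st.2.1 - st.1.1|) := by
          gcongr
          exact h1.trans (by gcongr; exact le_abs_self K)
      _ = |K| * (|st.2.1 - st.1.1|⁻¹ * |st.2.1 - st.1.1|) := by ring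
      _ ≤ |K| * 1 := by
          gcongr
          exact inv_mul_le_one
      _ = |K| := mul_one _)
  refine ⟨L, hL0, fun s hs t ht u v hu hv => ?_⟩
  rcases eq_or_ne s t with rfl | hst
  · simp
  have hpos : 0 < |t - s| := abs_pos.2 (sub_ne_zero.2 hst.symm)
  have hle : |q (⟨s, hs⟩, ⟨t, ht⟩) (withGradient u) (withGradient v)|
      ≤ L * (‖withGradient u‖ * ‖withGradient v‖) :=
    hL (⟨s, hs⟩, ⟨t, ht⟩) ⟨_, hu.withGradient_mem hΛ⟩ ⟨_, hv.withGradient_mem hΛ⟩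
  rw [hq, inv_mul_le_iff₀ hpos] at hle
  calc _ ≤ |t - s| * (L * (‖withGradient u‖ * ‖withGradient v‖)) := hle
    _ ≤ |t - s| * (L * (√(normH1Sq u) * √(normH1Sq v))) := by
        gcongr <;> exact norm_withGradient_le _
    _ = _ := by ring

end VolumeForm

/-! ### The discrete operators -/

section DiscreteOperators

variable {d : ℕ} {Λ : Set (Space d)}

lemma abs_integral_mul_le_sqrt_mul_sqrt {α : Type*} [MeasurableSpace α] {μ : Measure α}
    {f g : α → ℝ} (hf : MemLp f 2 μ) (hg : MemLp g 2 μ) :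
    |∫ x, f x * g x ∂μ| ≤ √(∫ x, f x * f x ∂μ) * √(∫ x, g x * g x ∂μ) := by
  have e : ∀ {f g : α → ℝ} (hf : MemLp f 2 μ) (hg : MemLp g 2 μ),
      inner ℝ hf.toLp hg.toLp = ∫ x, f x * g x ∂μ := by
    intro f g hf hg
    rw [L2.inner_def]
    refine integral_congr_ae ?_
    filter_upwards [hf.coeFn_toLp, hg.coeFn_toLp] with x hx hx'
    simp [hx, hx', mul_comm]
  have hn : ∀ {f : α → ℝ} (hf : MemLp f 2 μ), ‖hf.toLp‖ = √(∫ x, f x * f x ∂μ) := by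
    intro f hf
    rw [← e hf hf, real_inner_self_eq_norm_sq, Real.sqrt_sq (norm_nonneg _)]
  rw [← e hf hg, ← hn hf, ← hn hg]
  exact abs_real_inner_le_norm _ _

/-- The Cauchy-Schwarz inequality for the boundary form, which is definite of the sign of `α₀`. -/
lemma abs_boundaryForm_le (hΛ : IsOpen Λ) (hb : Bornology.IsBounded Λ) {bc : BoundaryCondition}
    (hfin : ∀ α₀ : ℝ, bc = .robin α₀ → α₀ ≠ 0 →
      Measure.euclideanHausdorffMeasure (d - 1) (frontier Λ) < ⊤)
    {u v : L2 Λ} (hu : ∃ f, IsContRep u f) (hv : ∃ f, IsContRep v f) :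
    |boundaryForm bc u v| ≤ √|boundaryForm bc u u| * √|boundaryForm bc v v| := by
  cases bc with
  | dirichlet => simp [boundaryForm]
  | robin α₀ =>
    by_cases h0 : α₀ = 0
    · simp [boundaryForm, h0]
    have hlt := hfin α₀ rfl h0
    set μ := (Measure.euclideanHausdorffMeasure (d - 1) : Measure (Space d)).restrict (frontier Λ)
      with hμ
    have : IsFiniteMeasure μ := ⟨by rwa [hμ, Measure.restrict_apply_univ]⟩
    have hm : MeasurableSet (frontier Λ) := isClosed_frontier.measurableSet
    have hL : ∀ {w : L2 Λ}, (∃ f, IsContRep w f) → MemLp (contRep w) 2 μ := by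
      rintro w ⟨f, hf⟩
      have hc : ContinuousOn (contRep w) (closure Λ) := hf.1.congr (hf.eqOn hΛ)
      obtain ⟨R, hR⟩ := hb.isCompact_closure.exists_bound_of_continuousOn hc
      refine MemLp.of_bound ((hc.mono frontier_subset_closure).aestronglyMeasurable hm) R ?_
      filter_upwards [ae_restrict_mem hm] with x hx
      exact hR x (frontier_subset_closure hx)
    have e : ∀ u v : L2 Λ, boundaryForm (.robin α₀) u v
        = α₀ * ∫ x, contRep u x * contRep v x ∂μ := by
      intro u v
      simp only [boundaryForm, mul_assoc]
      rw [integral_const_mul]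
    have hp : ∀ w : L2 Λ, 0 ≤ ∫ x, contRep w x * contRep w x ∂μ := fun w =>
      integral_nonneg fun x => mul_self_nonneg _
    rw [e, e, e, abs_mul, abs_mul, abs_mul, abs_of_nonneg (hp u), abs_of_nonneg (hp v),
      Real.sqrt_mul (abs_nonneg _), Real.sqrt_mul (abs_nonneg _)]
    calc _ ≤ |α₀| * (√(∫ x, contRep u x * contRep u x ∂μ)
          * √(∫ x, contRep v x * contRep v x ∂μ)) := by
          gcongr
          exact abs_integral_mul_le_sqrt_mul_sqrt (hL hu) (hL hv)
      _ = √|α₀| * √|α₀| * (√(∫ x, contRep u x * contRep u x ∂μ)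
          * √(∫ x, contRep v x * contRep v x ∂μ)) := by
          rw [Real.mul_self_sqrt (abs_nonneg _)]
      _ = _ := by ring

/-- The energy norm `(‖v‖₁² + |β(v,v)|)^{1/2}`, in which the forms `a(t)` are bounded. No trace
inequality holds on a general open set, so the norm of `H¹(Λ)` alone would not do. -/
noncomputable def energyNorm {bc : BoundaryCondition} {𝒯 : Triangulation Λ}
    (v : feSpace bc 𝒯) : ℝ :=
  √(normH1Sq (v : L2 Λ) + |boundaryForm bc (v : L2 Λ) (v : L2 Λ)|)

lemma energyNorm_nonneg {bc : BoundaryCondition} {𝒯 : Triangulation Λ} (v : feSpace bc 𝒯) :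
    0 ≤ energyNorm v :=
  Real.sqrt_nonneg _

lemma sqrt_normH1Sq_le_energyNorm {bc : BoundaryCondition} {𝒯 : Triangulation Λ}
    (v : feSpace bc 𝒯) : √(normH1Sq (v : L2 Λ)) ≤ energyNorm v :=
  Real.sqrt_le_sqrt (le_add_of_nonneg_right (abs_nonneg _))

lemma exists_contRep {bc : BoundaryCondition} {𝒯 : Triangulation Λ} (v : feSpace bc 𝒯) :
    ∃ f, IsContRep (v : L2 Λ) f :=
  let ⟨f, hf, hvf⟩ := v.2.2
  ⟨f, hf.1, hvf⟩

/-- The discrete operators are sectorial, uniformly in the triangulation and in time. In the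
coercivity estimate the boundary term is controlled through
`|β(v,v)| ≤ a(v,v) + |a_Λ(v,v)|`, whatever its sign. -/
lemma exists_isSectorial_discreteA (hΛ : IsOpen Λ) (hb : Bornology.IsBounded Λ) {T : ℝ}
    (hT : 0 ≤ T) {bc : BoundaryCondition} {co : Coefficients d} (hco : IsAdmissible Λ T bc co) :
    ∃ lam C : ℝ, 0 ≤ C ∧ ∀ (𝒯 : Triangulation Λ), ∀ t ∈ Set.Icc 0 T,
      IsSectorial (energyNorm (bc := bc) (𝒯 := 𝒯)) lam C (discreteA bc co 𝒯 t) := by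
  obtain ⟨l, hl, hcoer⟩ := hco.coercive
  obtain ⟨R, hR0, hR⟩ := exists_volumeForm_bound hΛ hb hT hco
  refine ⟨l / (l + R + 1), R + 1, by positivity, fun 𝒯 t ht => ⟨by positivity, by positivity,
    fun v => ?_, fun v => ?_, fun u v => ?_⟩⟩
  · refine Real.le_sqrt_of_sq_le ?_
    have h1 : ‖v‖ ^ 2 ≤ normH1Sq (v : L2 Λ) :=
      le_add_of_nonneg_right (Finset.sum_nonneg fun _ _ => by positivity)
    exact h1.trans (le_add_of_nonneg_right (abs_nonneg _))
  · rw [discreteA_spec hΛ hb hco 𝒯 ht, neg_neg]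
    have h1 := hcoer t ht v v.2.1 (exists_contRep v)
    have hN := normH1Sq_nonneg (v : L2 Λ)
    have h2 := hR t ht v v
    rw [Real.mul_self_sqrt hN] at h2
    have h3 : |boundaryForm bc (v : L2 Λ) (v : L2 Λ)|
        ≤ form bc co t (v : L2 Λ) (v : L2 Λ) + R * normH1Sq (v : L2 Λ) := by
      have e : boundaryForm bc (v : L2 Λ) (v : L2 Λ)
          = form bc co t (v : L2 Λ) (v : L2 Λ) - volumeForm co t (v : L2 Λ) (v : L2 Λ) := by
        simp [form]
      rw [e]
      refine (abs_sub _ _).trans (add_le_add ?_ h2)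
      rw [abs_of_nonneg ((mul_nonneg hl.le hN).trans h1)]
    rw [energyNorm, Real.sq_sqrt (by positivity), div_mul_eq_mul_div, div_le_iff₀ (by positivity)]
    have h4 : l * |boundaryForm bc (v : L2 Λ) (v : L2 Λ)|
        ≤ l * (form bc co t (v : L2 Λ) (v : L2 Λ) + R * normH1Sq (v : L2 Λ)) := by gcongr
    have h5 : (R + 1) * (l * normH1Sq (v : L2 Λ)) ≤ (R + 1) * form bc co t (v : L2 Λ) (v : L2 Λ) := by gcongr
    linarith
  · rw [discreteA_spec hΛ hb hco 𝒯 ht, abs_neg, form, add_mul, one_mul]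
    refine (abs_add_le _ _).trans (add_le_add ((hR t ht u v).trans ?_) ?_)
    · have := energyNorm_nonneg u
      gcongr <;> exact sqrt_normH1Sq_le_energyNorm _
    · refine (abs_boundaryForm_le hΛ hb hco.finite_boundary (exists_contRep u)
        (exists_contRep v)).trans ?_
      unfold energyNorm
      gcongr <;> exact le_add_of_nonneg_left (normH1Sq_nonneg _)

lemma exists_discreteA_lipschitz (hΛ : IsOpen Λ) (hb : Bornology.IsBounded Λ) {T : ℝ}
    (hT : 0 ≤ T) {bc : BoundaryCondition} {co : Coefficients d} (hco : IsAdmissible Λ T bc co) :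
    ∃ L : ℝ, 0 ≤ L ∧ ∀ (𝒯 : Triangulation Λ), ∀ s ∈ Set.Icc 0 T, ∀ t ∈ Set.Icc 0 T,
      ∀ u v : feSpace bc 𝒯, |inner ℝ ((discreteA bc co 𝒯 s - discreteA bc co 𝒯 t) u) v|
        ≤ L * |t - s| * (energyNorm u * energyNorm v) := by
  obtain ⟨L, hL0, hL⟩ := exists_volumeForm_lipschitz hΛ hb hT hco
  refine ⟨L, hL0, fun 𝒯 s hs t ht u v => ?_⟩
  rw [sub_apply, inner_sub_left, discreteA_spec hΛ hb hco 𝒯 hs, discreteA_spec hΛ hb hco 𝒯 ht,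
    form, form]
  have e : ∀ a b c : ℝ, -(a + c) - -(b + c) = b - a := fun a b c => by ring
  rw [e]
  refine (hL s hs t ht u v u.2.1 v.2.1).trans ?_
  have := energyNorm_nonneg u
  gcongr <;> exact sqrt_normH1Sq_le_energyNorm _

lemma norm_discreteJ_le {bc : BoundaryCondition} {𝒯 : Triangulation Λ} {F : ℝ → L2 Λ → L2 Λ}
    {K t : ℝ} (w : feSpace bc 𝒯) (h : ‖fderiv ℝ (F t) (w : L2 Λ)‖ ≤ K) :
    ‖discreteJ bc 𝒯 F t w‖ ≤ K := by
  refine ContinuousLinearMap.opNorm_le_bound _ ((norm_nonneg _).trans h) fun x => ?_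
  have h1 : ‖proj bc 𝒯‖ ≤ 1 := Submodule.orthogonalProjectionOnto_norm_le _
  calc ‖discreteJ bc 𝒯 F t w x‖ ≤ 1 * ‖fderiv ℝ (F t) (w : L2 Λ) x‖ :=
        (proj bc 𝒯).le_of_opNorm_le h1 _
    _ ≤ K * ‖(x : L2 Λ)‖ := by
        rw [one_mul]
        exact ContinuousLinearMap.le_of_opNorm_le _ h _

lemma midTime_mem_Icc {T : ℝ} (hT : 0 < T) {M j : ℕ} (hj : j < M) :
    midTime (T / M) j ∈ Set.Icc 0 T := by
  have hM : (0 : ℝ) < M := by exact_mod_cast (Nat.zero_le j).trans_lt hj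
  have h1 : (j : ℝ) + 1 ≤ M := by exact_mod_cast hj
  have h2 : ((j : ℝ) + 1) * (T / M) ≤ M * (T / M) := by gcongr
  rw [mul_div_cancel₀ T hM.ne'] at h2
  have h3 : 0 < T / M := by positivity
  unfold midTime
  exact ⟨by positivity, by linarith⟩

end DiscreteOperators

end MagnusRosenbrock

open MagnusRosenbrock

theorem mainTheorem4 {d : ℕ} (Λ : Set (MagnusRosenbrock.Space d)) (hΛ : IsOpen Λ)
    (hΛb : Bornology.IsBounded Λ) (T : ℝ) (hT : 0 < T)
    (bc : MagnusRosenbrock.BoundaryCondition) (co : MagnusRosenbrock.Coefficients d)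
    (hco : MagnusRosenbrock.IsAdmissible Λ T bc co)
    (F : ℝ → MagnusRosenbrock.L2 Λ → MagnusRosenbrock.L2 Λ) (K₃ : ℝ)
    (hF : MagnusRosenbrock.IsSmoothNonlinearity T F K₃)
    (γ : ℝ) (hγ₀ : 0 ≤ γ) (hγ₁ : γ < 1) :
    ∃ C : ℝ, ∀ (𝒯 : MagnusRosenbrock.Triangulation Λ) (u₀ : MagnusRosenbrock.L2 Λ)
      (M k m : ℕ), k ≤ m → m < M →
      ‖MagnusRosenbrock.orderedProd
            (MagnusRosenbrock.stepExp bc co 𝒯 F u₀ T (T / M)) k m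
          * MagnusRosenbrock.negPow
              (MagnusRosenbrock.discreteA bc co 𝒯 (MagnusRosenbrock.midTime (T / M) k)) γ‖
        ≤ C * (((m - k + 1 : ℕ) : ℝ) * (T / M)) ^ (-γ) := by
  obtain ⟨lam, C, hC, hA⟩ := exists_isSectorial_discreteA hΛ hΛb hT.le hco
  obtain ⟨L, hL0, hL⟩ := exists_discreteA_lipschitz hΛ hΛb hT.le hco
  have hK : 0 ≤ K₃ := (norm_nonneg _).trans (hF.bound_u 0 ⟨le_rfl, hT.le⟩ 0)
  refine ⟨productConst lam C L K₃ T γ, fun 𝒯 u₀ M k m hkm hm => ?_⟩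
  have hM : (0 : ℝ) < M := by exact_mod_cast (Nat.zero_le m).trans_lt hm
  have : CompleteSpace (feSpace bc 𝒯) := FiniteDimensional.complete ℝ _
  refine norm_orderedProd_mul_negPow_le hC hL0 hK (div_pos hT hM) hγ₀ hγ₁ hkm hm
    (mul_div_cancel₀ T hM.ne').le
    (A := fun j => discreteA bc co 𝒯 (midTime (T / M) j))
    (J := fun j => discreteJ bc 𝒯 F (midTime (T / M) j) (approx bc co 𝒯 F u₀ T (T / M) j))
    (fun j hj => hA 𝒯 _ (midTime_mem_Icc hT hj))
    (fun j hj => norm_discreteJ_le _ (hF.bound_u _ (midTime_mem_Icc hT hj) _))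
    fun i j hij hj u v => ?_
  have e : |midTime (T / M) j - midTime (T / M) i| = ((j - i : ℕ) : ℝ) * (T / M) := by
    rw [Nat.cast_sub hij, ← abs_of_nonneg (a := ((j : ℝ) - i) * (T / M))
      (mul_nonneg (sub_nonneg.2 (by exact_mod_cast hij)) (div_pos hT hM).le)]
    congr 1
    unfold midTime
    ring
  rw [← e]
  exact hL 𝒯 _ (midTime_mem_Icc hT (hij.trans_lt hj)) _ (midTime_mem_Icc hT hj) u v
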